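/- **Setting.** Fix an infinite set $U$ of possible agent names. A (symmetric) additively separable hedonic game $G=(N,w)$ consists of a finite set $N\subseteq U$ of agents and a weight function $w\colon\binom N2\to\mathbb Q$. For a partition $\pi$ of $N$ write $\pi(i)$ for the coalition containing $i$; its social welfare is $SW(\pi)=\sum_{i\in N}\sum_{j\in\pi(i)\setminus\{i\}}w(\{i,j\})$. Let $SW(\pi^*(G))$ be the maximum of $SW(\pi)$ over all partitions $\pi$ of $N$. A matching is a partition all of whose coalitions have size at most $2$; let $SW(\mu^*(G))$ be the maximum of $SW$ over all matchings (twice the maximum weight of a matching). For $G=(N,w)$ with $n=|N|$ and an order $\sigma\colon\{1,\dots,n\}\to N$ (a bijection), let $G_i$ be the subgame of $G$ induced by $\{\sigma(1),\dots,\sigma(i)\}$. A (deterministic) online coalition formation algorithm $ALG$ produces, for every such $(G,\sigma)$ and every $i\le n$, a partition $\pi_i$ of $\{\sigma(1),\dots,\sigma(i)\}$ that is determined by $G_1,\dots,G_i$ alone (in particular, $n$ is not known), such that for $i\ge 2$ the partition $\pi_i$ arises from $\pi_{i-1}$ by adding $\sigma(i)$ to an existing coalition or as a new singleton coalition. Its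 output is $ALG(G,\sigma)=\pi_n$. It is an online matching algorithm if all $\pi_i$ are matchings. In the random arrival model, $\sigma$ is uniformly random among all orders of $N$. With the conventions $\frac00=1$ and $\frac x0=0$ for $x<0$, $ALG$ is *$c$-competitive* ($c\in\mathbb R$) if $\mathbb E_\sigma[SW(ALG(G,\sigma))]/SW(\pi^*(G))\ge c$ for all $G$, and its *competitive ratio* is the supremum of all $c$ for which it is $c$-competitive. An online matching algorithm is a *$c$-competitive online matching algorithm for a class $D$ of games* if $\mathbb E_\sigma[SW(ALG(G,\sigma))]/SW(\mu^*(G))\ge c$ for all $G\in D$. The *tree domain* is the class of games in which every connected component of the graph of positive-weight edges is a tree and every negative-weight edge is larger in absolute value than the sum of all positive edge weights. **Proposition.** In the random arrival model, the following hold. 1. Let $c\le 1$. If there is no $c$-competitive online matching algorithm for the tree domain, then there is no $c$-competitive online coalition formation algorithm. 2. No online coalition formation algorithm has a competitive ratio of more than $\frac13$. -/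

import Mathlib

/-- The additively separable hedonic game given by a complete undirected weighted graph
`G = (N, w)`. Agents carry names from a type `U`; `agents` is the finite set `N`, and `weight i j`
is the rational weight of the edge `{i, j}`. The weight is extended by `0` to all pairs of names
that are not an edge of `G`, so that a game carries no information besides `N` and `w`. -/
@[ext]
structure ASHG (U : Type*) where
  agents : Finset U
  weight : U → U → ℚ
  weight_symm : ∀ i j, weight i j = weight j i
  weight_eq_zero : ∀ i j, ¬ (i ∈ agents ∧ j ∈ agents ∧ i ≠ j) → weight i j = 0

/-- `π` is a partition (coalition structure) of `N`. -/
def IsPartitionOf {U : Type*} [DecidableEq U] (π : Finset (Finset U)) (N : Finset U) : Prop :=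
  ∃ P : Finpartition N, P.parts = π

/-- `π(i)`: for a partition `π`, the coalition of `π` that contains `i`. -/
def coalitionOf {U : Type*} [DecidableEq U] (π : Finset (Finset U)) (i : U) : Finset U :=
  (π.filter fun C => i ∈ C).biUnion id

/-- `π - i`: the partition `π` restricted to the agents other than `i`. -/
def removeAgent {U : Type*} [DecidableEq U] (π : Finset (Finset U)) (i : U) :
    Finset (Finset U) :=
  (π.image fun C => C.erase i).filter fun C => C.Nonempty

namespace ASHG

variable {U : Type*} [DecidableEq U]

/-- The game `G[S]` induced by the agents in `S`. -/
def induce (G : ASHG U) (S : Finset U) : ASHG U where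
  agents := G.agents ∩ S
  weight i j := if i ∈ S ∧ j ∈ S then G.weight i j else 0
  weight_symm i j := by simp only [G.weight_symm i j, and_comm]
  weight_eq_zero i j h := by
    split_ifs with hS
    · exact G.weight_eq_zero i j fun h' => h
        ⟨Finset.mem_inter.2 ⟨h'.1, hS.1⟩, Finset.mem_inter.2 ⟨h'.2.1, hS.2⟩, h'.2.2⟩
    · rfl

/-- The utility `u_i(C)` of agent `i` for a coalition `C` containing `i`. -/
def utility (G : ASHG U) (i : U) (C : Finset U) : ℚ := ∑ j ∈ C.erase i, G.weight i j

/-- The utilitarian social welfare of a partition of the agents. -/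
def socialWelfare (G : ASHG U) (π : Finset (Finset U)) : ℚ :=
  ∑ i ∈ G.agents, G.utility i (coalitionOf π i)

/-- The social welfare of a welfare-optimal partition. -/
def optWelfare (G : ASHG U) : ℚ :=
  (Finset.univ : Finset (Finpartition G.agents)).sup' ⟨⊥, Finset.mem_univ _⟩
    fun P => G.socialWelfare P.parts

end ASHG

/-- A matching: all coalitions have size at most two. -/
def IsMatching {U : Type*} (π : Finset (Finset U)) : Prop := ∀ C ∈ π, C.card ≤ 2

instance {U : Type*} (π : Finset (Finset U)) : Decidable (IsMatching π) :=
  inferInstanceAs (Decidable (∀ C ∈ π, C.card ≤ 2))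

namespace ASHG

variable {U : Type*} [DecidableEq U]

/-- The maximum social welfare of a matching. As the social welfare of a matching is twice its
weight, it is attained by the maximum weight matchings. -/
def optMatchingWelfare (G : ASHG U) : ℚ :=
  ((Finset.univ : Finset (Finpartition G.agents)).filter fun P => IsMatching P.parts).sup'
    ⟨⊥, Finset.mem_filter.2 ⟨Finset.mem_univ _, fun C hC => by
      obtain ⟨a, -, rfl⟩ := Finpartition.mem_bot_iff.1 hC
      simp⟩⟩
    fun P => G.socialWelfare P.parts

/-- The orders `Σ(N)` of the agent set. -/
abbrev Order (G : ASHG U) : Type _ := Fin G.agents.card ≃ G.agents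

/-- The set of the first `i` arriving agents. -/
def arrived (G : ASHG U) (σ : G.Order) (i : ℕ) : Finset U :=
  (Finset.univ.filter fun k : Fin G.agents.card => (k : ℕ) < i).image fun k => (σ k : U)

/-- The input `G_1, …, G_i` revealed up to step `i`, where `G_k` is the game induced by the first
`k` arriving agents. -/
def inputSeq (G : ASHG U) (σ : G.Order) (i : ℕ) : List (ASHG U) :=
  (List.range i).map fun k => G.induce (G.arrived σ (k + 1))

/-- The graph of the edges of positive weight. -/
def positiveGraph (G : ASHG U) : SimpleGraph U where
  Adj i j := 0 < G.weight i j
  symm := ⟨fun i j h => by rwa [G.weight_symm j i]⟩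
  loopless := ⟨fun i h => by simp [G.weight_eq_zero i i (by simp)] at h⟩

/-- The sum of all positive edge weights. Every edge occurs as two ordered pairs, hence the
division by `2`. -/
def positiveWeight (G : ASHG U) : ℚ :=
  (∑ i ∈ G.agents, ∑ j ∈ G.agents, max (G.weight i j) 0) / 2

/-- The tree domain: every connected component of the graph of positive edges is a tree
(i.e. this graph is acyclic), and every negative edge is larger in absolute value than the sum of
all positive edge weights. -/
def treeDomain (U : Type*) [DecidableEq U] : Set (ASHG U) :=
  {G | G.positiveGraph.IsAcyclic ∧ ∀ i j, G.weight i j < 0 → G.positiveWeight < |G.weight i j|}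

end ASHG

/-- A deterministic online coalition formation algorithm. From the input `G_1, …, G_i` seen so far,
it produces the partition `π_i` of the first `i` arriving agents; the total number of agents is not
part of the input. Every partition has to extend the previous one: `π_{i+1} - σ(i+1) = π_i`.
(The positions of `σ` are counted from `0`, so the agent arriving in step `i + 1` is `σ i`.)
Only the values of `run` on input sequences of instances matter. -/
structure OnlineAlgorithm (U : Type*) [DecidableEq U] where
  run : List (ASHG U) → Finset (Finset U)
  isPartitionOf : ∀ (G : ASHG U) (σ : G.Order) (i : ℕ), i ≤ G.agents.card →
    IsPartitionOf (run (G.inputSeq σ i)) (G.arrived σ i)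
  irrevocable : ∀ (G : ASHG U) (σ : G.Order) (i : Fin G.agents.card),
    removeAgent (run (G.inputSeq σ (i + 1))) (σ i) = run (G.inputSeq σ i)

/-- The quotient `x / y` with the conventions `0 / 0 = 1` and `x / 0 = 0` for `x < 0`
(for the quotients considered here, `x > 0 = y` does not occur). -/
noncomputable def welfareRatio (x y : ℚ) : ℝ :=
  if y = 0 then (if x = 0 then 1 else 0) else (x : ℝ) / (y : ℝ)

namespace OnlineAlgorithm

variable {U : Type*} [DecidableEq U]

/-- The output `ALG(G, σ)`. -/
def output (A : OnlineAlgorithm U) (G : ASHG U) (σ : G.Order) : Finset (Finset U) :=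
  A.run (G.inputSeq σ G.agents.card)

/-- The algorithm is an online matching algorithm: it creates a matching in every step. -/
def IsMatchingAlgorithm (A : OnlineAlgorithm U) : Prop :=
  ∀ (G : ASHG U) (σ : G.Order) (i : ℕ), i ≤ G.agents.card → IsMatching (A.run (G.inputSeq σ i))

/-- The expected social welfare of the output for a uniformly random arrival order. -/
def expectedWelfare (A : OnlineAlgorithm U) (G : ASHG U) : ℚ :=
  (∑ σ : G.Order, G.socialWelfare (A.output G σ)) / Fintype.card G.Order

/-- `A` is `c`-competitive for online coalition formation under random arrival. -/
def IsCompetitive (A : OnlineAlgorithm U) (c : ℝ) : Prop :=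
  ∀ G : ASHG U, c ≤ welfareRatio (A.expectedWelfare G) G.optWelfare

/-- `A` is a `c`-competitive online matching algorithm on the domain `D` under random arrival. -/
def IsCompetitiveMatchingOn (A : OnlineAlgorithm U) (D : Set (ASHG U)) (c : ℝ) : Prop :=
  A.IsMatchingAlgorithm ∧
    ∀ G ∈ D, c ≤ welfareRatio (A.expectedWelfare G) G.optMatchingWelfare

/-- The competitive ratio under random arrival: the supremum of all `c` such that `A` is
`c`-competitive (it is `-∞` if there is no such `c`). -/
noncomputable def competitiveRatio (A : OnlineAlgorithm U) : EReal :=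
  sSup ((fun c : ℝ => (c : EReal)) '' {c : ℝ | A.IsCompetitive c})

end OnlineAlgorithm

/-! For the first statement, let `A` be a coalition formation algorithm and `G` a game of the tree
domain. Replace every nonpositive edge weight of `G` by `-M`. An acyclic graph has no triangle, so
every coalition of at least two agents other than a positive edge contains a penalized pair; once
`M` is at least twice the total positive weight, such a coalition has nonpositive value. Simulating
`A` on the penalized game and keeping the positive pairs that it ever forms is therefore an online
matching algorithm that does at least as well on `G` (`socialWelfare_penalize_le`), while the
penalized optimum is at least the matching optimum of `G`. A suitable `M` is not known online. An
ultrafilter limit over all `M` removes it: on each game the limit agrees with the simulation for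
some sufficiently large `M` (`exists_limit`).

For the second statement, consider a double star: two adjacent centers with `K` leaves each, all
weights powers of a large `W`, and the central edge heaviest. A history does not reveal whether more
agents follow, so a `c`-competitive matching algorithm must, for every set of arrived agents, hold
the heaviest present edge with probability at least about `c` (`le_pairProb`). Conditioning on the
last arrival gives recursions for matching probabilities. While one center is absent, the other is
matched with probability about `2c` (`add_pairProb_le_matchProb`): `c` for the current best leaf,
and nearly `c` for matches with earlier best leaves. If the second center arrives later, it finds
the first one free with probability at most about `1 - 2c`, so the central edge is chosen with
probability at most about `1 - 2c` (`pairProb_le`). It has to be chosen with probability about `c`,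
so `c` cannot exceed `1/3`. The reduction carries this bound over to coalition formation. -/

open Finset

/-! ### Partitions, and matchings described by their pairs -/

section Partitions

variable {U : Type*} [DecidableEq U]

theorem isPartitionOf_iff {π : Finset (Finset U)} {N : Finset U} :
    IsPartitionOf π N ↔ (∀ C ∈ π, C ⊆ N ∧ C.Nonempty) ∧ (∀ x ∈ N, ∃ C ∈ π, x ∈ C) ∧
      ∀ C ∈ π, ∀ D ∈ π, ∀ x, x ∈ C → x ∈ D → C = D := by
  constructor
  · rintro ⟨P, rfl⟩
    exact ⟨fun C hC => ⟨P.le hC, P.nonempty_of_mem_parts hC⟩, fun x hx => P.exists_mem hx,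
      fun C hC D hD x hx hx' => P.eq_of_mem_parts hC hD hx hx'⟩
  · rintro ⟨h1, h2, h3⟩
    refine ⟨Finpartition.ofExistsUnique π (fun C hC => (h1 C hC).1) (fun x hx => ?_)
      fun h => by simpa using (h1 _ h).2, rfl⟩
    obtain ⟨C, hC, hxC⟩ := h2 x hx
    exact ⟨C, ⟨hC, hxC⟩, fun D hD => h3 D hD.1 C hC x hD.2 hxC⟩

theorem IsPartitionOf.subset {π : Finset (Finset U)} {N C : Finset U} (h : IsPartitionOf π N)
    (hC : C ∈ π) : C ⊆ N := ((isPartitionOf_iff.1 h).1 C hC).1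

theorem IsPartitionOf.nonempty {π : Finset (Finset U)} {N C : Finset U} (h : IsPartitionOf π N)
    (hC : C ∈ π) : C.Nonempty := ((isPartitionOf_iff.1 h).1 C hC).2

theorem IsPartitionOf.exists_mem {π : Finset (Finset U)} {N : Finset U} (h : IsPartitionOf π N)
    {x : U} (hx : x ∈ N) : ∃ C ∈ π, x ∈ C := (isPartitionOf_iff.1 h).2.1 x hx

theorem IsPartitionOf.eq_of_mem {π : Finset (Finset U)} {N C D : Finset U}
    (h : IsPartitionOf π N) (hC : C ∈ π) (hD : D ∈ π) {x : U} (hxC : x ∈ C) (hxD : x ∈ D) :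
    C = D := (isPartitionOf_iff.1 h).2.2 C hC D hD x hxC hxD

theorem IsPartitionOf.coalitionOf_eq {π : Finset (Finset U)} {N C : Finset U}
    (h : IsPartitionOf π N) (hC : C ∈ π) {x : U} (hx : x ∈ C) : coalitionOf π x = C := by
  have : π.filter (fun D => x ∈ D) = {C} := by
    ext D
    simp only [mem_filter, mem_singleton]
    exact ⟨fun hD => h.eq_of_mem hD.1 hC hD.2 hx, by rintro rfl; exact ⟨hC, hx⟩⟩
  rw [coalitionOf, this, singleton_biUnion, id]

theorem mem_removeAgent {π : Finset (Finset U)} {v : U} {D : Finset U} :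
    D ∈ removeAgent π v ↔ (∃ C ∈ π, C.erase v = D) ∧ D.Nonempty := by
  simp [removeAgent]

/-- The matching of `N` whose coalitions of size two are the members of `P`. -/
def pairing (N : Finset U) (P : Finset (Finset U)) : Finset (Finset U) :=
  P ∪ (N \ P.biUnion id).image fun x => {x}

/-- `P` is a set of pairwise disjoint pairs of elements of `N`. -/
def IsPairSet (N : Finset U) (P : Finset (Finset U)) : Prop :=
  (∀ C ∈ P, C ⊆ N ∧ C.card = 2) ∧ ∀ C ∈ P, ∀ D ∈ P, ∀ x, x ∈ C → x ∈ D → C = D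

theorem mem_pairing {N : Finset U} {P : Finset (Finset U)} {C : Finset U} :
    C ∈ pairing N P ↔ C ∈ P ∨ ∃ x ∈ N, (∀ D ∈ P, x ∉ D) ∧ C = {x} := by
  simp only [pairing, mem_union, mem_image, mem_sdiff, mem_biUnion, id, not_exists, not_and]
  constructor
  · rintro (h | ⟨x, ⟨h1, h2⟩, rfl⟩)
    · exact Or.inl h
    · exact Or.inr ⟨x, h1, h2, rfl⟩
  · rintro (h | ⟨x, h1, h2, rfl⟩)
    · exact Or.inl h
    · exact Or.inr ⟨x, ⟨h1, h2⟩, rfl⟩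

theorem IsPairSet.isPartitionOf_pairing {N : Finset U} {P : Finset (Finset U)}
    (h : IsPairSet N P) : IsPartitionOf (pairing N P) N := by
  rw [isPartitionOf_iff]
  refine ⟨fun C hC => ?_, fun x hx => ?_, fun C hC D hD x hxC hxD => ?_⟩
  · rcases mem_pairing.1 hC with hC | ⟨x, hx, -, rfl⟩
    · exact ⟨(h.1 C hC).1, card_pos.1 (by rw [(h.1 C hC).2]; norm_num)⟩
    · simpa using hx
  · by_cases hP : ∃ D ∈ P, x ∈ D
    · obtain ⟨D, hD, hxD⟩ := hP
      exact ⟨D, mem_pairing.2 (Or.inl hD), hxD⟩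
    · push Not at hP
      exact ⟨{x}, mem_pairing.2 (Or.inr ⟨x, hx, hP, rfl⟩), by simp⟩
  · rcases mem_pairing.1 hC with hC | ⟨y, -, hy, rfl⟩ <;>
      rcases mem_pairing.1 hD with hD | ⟨z, -, hz, rfl⟩
    · exact h.2 C hC D hD x hxC hxD
    · rw [mem_singleton.1 hxD] at hxC
      exact absurd hxC (hz C hC)
    · rw [mem_singleton.1 hxC] at hxD
      exact absurd hxD (hy D hD)
    · rw [← mem_singleton.1 hxC, ← mem_singleton.1 hxD]

theorem IsPairSet.isMatching_pairing {N : Finset U} {P : Finset (Finset U)}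
    (h : IsPairSet N P) : IsMatching (pairing N P) := by
  intro C hC
  rcases mem_pairing.1 hC with hC | ⟨x, -, -, rfl⟩
  · exact (h.1 C hC).2.le
  · simp

/-- This is irrevocability in terms of pairs: the arrival of `v` may only add a pair containing `v`.
Deleting `v` turns that pair into a singleton, and by disjointness its remaining agent lies in no
member of `P`. -/
theorem removeAgent_pairing {N : Finset U} {P Q : Finset (Finset U)} {v : U} (hv : v ∉ N)
    (hQ : IsPairSet (insert v N) Q) (hPQ : ∀ C, C ∈ P ↔ C ∈ Q ∧ v ∉ C) :
    removeAgent (pairing (insert v N) Q) v = pairing N P := by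
  ext D
  rw [mem_removeAgent, mem_pairing]
  constructor
  · rintro ⟨⟨C, hC, rfl⟩, hne⟩
    rcases mem_pairing.1 hC with hC | ⟨x, hx, hxQ, rfl⟩
    · by_cases hvC : v ∈ C
      · have hc : (C.erase v).card = 1 := by rw [card_erase_of_mem hvC, (hQ.1 C hC).2]
        obtain ⟨x, hx⟩ := card_eq_one.1 hc
        have hxC : x ∈ C.erase v := by simp [hx]
        have hxv := mem_erase.1 hxC
        refine Or.inr ⟨x, ?_, fun D hD hxD => ?_, hx⟩
        · exact (mem_insert.1 ((hQ.1 C hC).1 hxv.2)).resolve_left hxv.1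
        · have := (hPQ D).1 hD
          rw [hQ.2 D this.1 C hC x hxD hxv.2] at this
          exact this.2 hvC
      · rw [erase_eq_of_notMem hvC]
        exact Or.inl ((hPQ C).2 ⟨hC, hvC⟩)
    · have hxv : x ≠ v := by
        rintro rfl
        simp at hne
      rw [erase_eq_of_notMem (by simpa using hxv.symm)]
      exact Or.inr ⟨x, (mem_insert.1 hx).resolve_left hxv,
        fun D hD => hxQ D ((hPQ D).1 hD).1, rfl⟩
  · rintro (hD | ⟨x, hx, hxP, rfl⟩)
    · have h := (hPQ D).1 hD
      refine ⟨⟨D, mem_pairing.2 (Or.inl h.1), erase_eq_of_notMem h.2⟩, ?_⟩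
      exact card_pos.1 (by rw [(hQ.1 D h.1).2]; norm_num)
    · have hxv : x ≠ v := by
        rintro rfl
        exact hv hx
      refine ⟨?_, by simp⟩
      by_cases hxQ : ∃ C ∈ Q, x ∈ C
      · obtain ⟨C, hC, hxC⟩ := hxQ
        have hvC : v ∈ C := by
          by_contra hvC
          exact hxP C ((hPQ C).2 ⟨hC, hvC⟩) hxC
        refine ⟨C, mem_pairing.2 (Or.inl hC), ?_⟩
        have hc : (C.erase v).card = 1 := by rw [card_erase_of_mem hvC, (hQ.1 C hC).2]
        obtain ⟨y, hy⟩ := card_eq_one.1 hc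
        have : x ∈ C.erase v := mem_erase.2 ⟨hxv, hxC⟩
        rw [hy] at this ⊢
        rw [mem_singleton.1 this]
      · push Not at hxQ
        exact ⟨{x}, mem_pairing.2 (Or.inr ⟨x, mem_insert_of_mem hx, hxQ, rfl⟩),
          erase_eq_of_notMem (by simpa using hxv.symm)⟩

end Partitions

/-! ### Welfare as a sum over coalitions, and arrival prefixes -/

namespace ASHG

theorem weight_self {U : Type*} (G : ASHG U) (x : U) : G.weight x x = 0 :=
  G.weight_eq_zero x x (by simp)

/-- Twice the total weight of the edges inside `C`. -/
def value {U : Type*} (G : ASHG U) (C : Finset U) : ℚ := ∑ x ∈ C, ∑ y ∈ C, G.weight x y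

variable {U : Type*} [DecidableEq U]

theorem value_singleton {U : Type*} (G : ASHG U) (x : U) : G.value {x} = 0 := by
  simp [value, weight_self]

theorem socialWelfare_eq_sum_value {G : ASHG U} {π : Finset (Finset U)}
    (h : IsPartitionOf π G.agents) : G.socialWelfare π = ∑ C ∈ π, G.value C := by
  have hu : π.biUnion id = G.agents := by
    ext x
    simp only [mem_biUnion, id]
    exact ⟨fun ⟨C, hC, hx⟩ => h.subset hC hx, fun hx => h.exists_mem hx⟩
  rw [socialWelfare, ← hu, sum_biUnion]
  · refine sum_congr rfl fun C hC => sum_congr rfl fun x hx => ?_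
    rw [h.coalitionOf_eq hC hx, utility]
    exact sum_erase _ (G.weight_self x)
  · intro C hC D hD hCD
    refine disjoint_left.2 fun x hxC hxD => hCD (h.eq_of_mem hC hD hxC hxD)

theorem value_pair (G : ASHG U) {x y : U} (hxy : x ≠ y) :
    G.value {x, y} = 2 * G.weight x y := by
  simp only [value, sum_pair hxy, weight_self, G.weight_symm y x]
  ring

theorem socialWelfare_pairing {G : ASHG U} {P : Finset (Finset U)} (h : IsPairSet G.agents P) :
    G.socialWelfare (pairing G.agents P) = ∑ C ∈ P, G.value C := by
  rw [socialWelfare_eq_sum_value h.isPartitionOf_pairing]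
  refine (sum_subset (fun C hC => mem_pairing.2 (Or.inl hC)) fun C hC hCP => ?_).symm
  rcases mem_pairing.1 hC with hC | ⟨x, -, -, rfl⟩
  · exact absurd hC hCP
  · exact G.value_singleton x

theorem arrived_subset (G : ASHG U) (σ : G.Order) (i : ℕ) : G.arrived σ i ⊆ G.agents := by
  intro x hx
  obtain ⟨k, -, rfl⟩ := mem_image.1 hx
  exact (σ k).2

@[simp] theorem arrived_zero (G : ASHG U) (σ : G.Order) : G.arrived σ 0 = ∅ := by
  simp [arrived]

theorem arrived_card (G : ASHG U) (σ : G.Order) : G.arrived σ G.agents.card = G.agents := by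
  refine (G.arrived_subset σ _).antisymm fun x hx => ?_
  refine mem_image.2 ⟨σ.symm ⟨x, hx⟩, by simp, by simp⟩

theorem arrived_mono (G : ASHG U) (σ : G.Order) {i j : ℕ} (h : i ≤ j) :
    G.arrived σ i ⊆ G.arrived σ j :=
  image_subset_image fun k hk => by
    simp only [mem_filter, mem_univ, true_and] at hk ⊢
    omega

theorem arrived_succ (G : ASHG U) (σ : G.Order) (i : Fin G.agents.card) :
    G.arrived σ (i + 1) = insert (σ i : U) (G.arrived σ i) := by
  rw [arrived, arrived, ← image_insert (fun k => (σ k : U))]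
  congr 1
  ext k
  simp only [mem_filter, mem_univ, true_and, mem_insert, Fin.ext_iff]
  omega

theorem notMem_arrived (G : ASHG U) (σ : G.Order) (i : Fin G.agents.card) :
    (σ i : U) ∉ G.arrived σ i := by
  intro h
  obtain ⟨k, hk, hki⟩ := mem_image.1 h
  have := σ.injective (Subtype.ext hki)
  subst this
  simp at hk

theorem induce_agents_of_subset (G : ASHG U) {S : Finset U} (h : S ⊆ G.agents) :
    (G.induce S).agents = S := inter_eq_right.2 h

@[simp] theorem length_inputSeq (G : ASHG U) (σ : G.Order) (i : ℕ) :
    (G.inputSeq σ i).length = i := by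
  simp [inputSeq]

theorem take_inputSeq (G : ASHG U) (σ : G.Order) {i k : ℕ} (h : k ≤ i) :
    (G.inputSeq σ i).take k = G.inputSeq σ k := by
  rw [inputSeq, ← List.map_take, List.take_range, min_eq_left h, inputSeq]

theorem inputSeq_succ (G : ASHG U) (σ : G.Order) (i : ℕ) :
    G.inputSeq σ (i + 1) = G.inputSeq σ i ++ [G.induce (G.arrived σ (i + 1))] := by
  simp [inputSeq, List.range_succ]

theorem agents_getLast?_inputSeq (G : ASHG U) (σ : G.Order) (i : ℕ) :
    ((G.inputSeq σ i).getLast?.map agents).getD ∅ = G.arrived σ i := by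
  obtain _ | i := i
  · simp [inputSeq]
  · simp [inputSeq_succ, G.induce_agents_of_subset (G.arrived_subset σ _)]

end ASHG

/-! ### Growth of coalitions and limits of online algorithms -/

namespace OnlineAlgorithm

variable {U : Type*} [DecidableEq U]

theorem subset_of_mem_run (A : OnlineAlgorithm U) {G : ASHG U} {σ : G.Order} {k i : ℕ}
    (hki : k ≤ i) (hi : i ≤ G.agents.card) {C D : Finset U} (hC : C ∈ A.run (G.inputSeq σ k))
    (hD : D ∈ A.run (G.inputSeq σ i)) {x : U} (hxC : x ∈ C) (hxD : x ∈ D) : C ⊆ D := by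
  induction i, hki using Nat.le_induction generalizing D with
  | base => rw [(A.isPartitionOf G σ k hi).eq_of_mem hC hD hxC hxD]
  | succ i hki ih =>
    have hirr := A.irrevocable G σ ⟨i, hi⟩
    simp only at hirr
    have hx : x ∈ G.arrived σ i :=
      G.arrived_mono σ hki ((A.isPartitionOf G σ k (by omega)).subset hC hxC)
    have hxi : x ≠ σ ⟨i, hi⟩ := by
      rintro rfl
      exact G.notMem_arrived σ ⟨i, hi⟩ hx
    have hxD' : x ∈ D.erase (σ ⟨i, hi⟩) := mem_erase.2 ⟨hxi, hxD⟩
    refine (ih (by omega) (D := D.erase (σ ⟨i, hi⟩)) ?_ hxD').trans (erase_subset _ _)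
    rw [← hirr]
    exact mem_removeAgent.2 ⟨⟨D, hD, rfl⟩, ⟨x, hxD'⟩⟩

theorem isPartitionOf_output (A : OnlineAlgorithm U) (G : ASHG U) (σ : G.Order) :
    IsPartitionOf (A.output G σ) G.agents := by
  have := A.isPartitionOf G σ _ le_rfl
  rwa [G.arrived_card σ] at this

/-- Online algorithms whose decisions agree, on every game, with those of almost all members of a
sequence of online algorithms. -/
theorem exists_limit (B : ℕ → OnlineAlgorithm U) : ∃ A : OnlineAlgorithm U, ∀ G : ASHG U,
    ∀ᶠ M in (Filter.hyperfilter ℕ : Filter ℕ), ∀ (σ : G.Order), ∀ i ≤ G.agents.card,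
      A.run (G.inputSeq σ i) = (B M).run (G.inputSeq σ i) := by
  classical
  let F : Ultrafilter ℕ := Filter.hyperfilter ℕ
  let run : List (ASHG U) → Finset (Finset U) := fun L =>
    -- The default `∅` is harmless: on input sequences of instances an eventual value exists.
    if h : ∃ π, ∀ᶠ M in (F : Filter ℕ), (B M).run L = π then h.choose else ∅
  have hrun : ∀ (G : ASHG U), ∀ᶠ M in (F : Filter ℕ), ∀ (σ : G.Order), ∀ i ≤ G.agents.card,
      run (G.inputSeq σ i) = (B M).run (G.inputSeq σ i) := by
    intro G
    rw [Filter.eventually_all]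
    intro σ
    have : ∀ i ∈ Set.Iic G.agents.card, ∀ᶠ M in (F : Filter ℕ),
        run (G.inputSeq σ i) = (B M).run (G.inputSeq σ i) := by
      intro i hi
      have hex : ∃ π, ∀ᶠ M in (F : Filter ℕ), (B M).run (G.inputSeq σ i) = π := by
        -- Only finitely many values are possible, since each is a family of subsets of the arrived
        -- agents; hence the ultrafilter selects one of them.
        have hfin : ((((G.arrived σ i).powerset).powerset : Finset _) :
          Set (Finset (Finset U))).Finite := Finset.finite_toSet _
        have := (Ultrafilter.eventually_exists_mem_iff (f := F) hfin
          (P := fun π M => (B M).run (G.inputSeq σ i) = π)).1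
          (Filter.Eventually.of_forall fun M => ⟨_, by
            simp only [coe_powerset, Set.mem_preimage, Set.mem_powerset_iff]
            intro C hC
            have := ((B M).isPartitionOf G σ i hi).subset hC
            simpa using this, rfl⟩)
        obtain ⟨π, -, hπ⟩ := this
        exact ⟨π, hπ⟩
      filter_upwards [hex.choose_spec] with M hM
      simp only [run, dif_pos hex]
      exact hM.symm
    exact (Filter.eventually_all_finite (Set.finite_Iic _)).2 this
  refine ⟨⟨run, fun G σ i hi => ?_, fun G σ i => ?_⟩, hrun⟩
  · obtain ⟨M, hM⟩ := (hrun G).exists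
    rw [hM σ i hi]
    exact (B M).isPartitionOf G σ i hi
  · obtain ⟨M, hM⟩ := (hrun G).exists
    rw [hM σ _ i.2, hM σ _ i.2.le]
    exact (B M).irrevocable G σ i

end OnlineAlgorithm

/-! ### Penalized games -/

namespace ASHG

variable {U : Type*} [DecidableEq U]

/-- The game in which every edge that is not of positive weight gets the weight `-M`. -/
def penalize (M : ℚ) (G : ASHG U) : ASHG U where
  agents := G.agents
  weight x y := if x ∈ G.agents ∧ y ∈ G.agents ∧ x ≠ y then
    (if 0 < G.weight x y then G.weight x y else -M) else 0
  weight_symm x y := by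
    simp only [G.weight_symm x y, ne_comm (a := x), ← and_assoc, and_comm (a := x ∈ G.agents)]
  weight_eq_zero x y h := if_neg h

theorem mem_agents_of_weight_pos {U : Type*} {G : ASHG U} {x y : U} (h : 0 < G.weight x y) :
    x ∈ G.agents ∧ y ∈ G.agents ∧ x ≠ y := by
  by_contra hn
  rw [G.weight_eq_zero x y hn] at h
  exact lt_irrefl _ h

theorem penalize_weight_of_pos {M : ℚ} {G : ASHG U} {x y : U} (h : 0 < G.weight x y) :
    (G.penalize M).weight x y = G.weight x y := by
  simp only [penalize]
  rw [if_pos (mem_agents_of_weight_pos h), if_pos h]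

theorem penalize_induce (M : ℚ) (G : ASHG U) (S : Finset U) :
    (G.induce S).penalize M = (G.penalize M).induce S := by
  ext x y
  · rfl
  · simp only [penalize, induce, mem_inter]
    by_cases hx : x ∈ S <;> by_cases hy : y ∈ S <;> simp [hx, hy]

/-- The penalty is imposed edge by edge, so the penalized history can be computed from the original
one as it is revealed. This makes the simulation online. -/
theorem inputSeq_penalize (M : ℚ) (G : ASHG U) (σ : G.Order) (i : ℕ) :
    (G.penalize M).inputSeq σ i = (G.inputSeq σ i).map (penalize M) := by
  simp only [inputSeq, List.map_map]
  refine List.map_congr_left fun k _ => ?_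
  rw [Function.comp, penalize_induce]
  rfl

end ASHG

/-! ### The simulated matching algorithm -/

namespace OnlineAlgorithm

variable {U : Type*} [DecidableEq U]

open Classical in
/-- The pairs of positive weight that the simulation of `A` on the penalized games has formed at
some point. -/
noncomputable def positivePairs (A : OnlineAlgorithm U) (M : ℚ) (L : List (ASHG U)) :
    Finset (Finset U) :=
  (range (L.length + 1)).biUnion fun k =>
    (A.run ((L.take k).map (ASHG.penalize M))).filter fun C =>
      C.card = 2 ∧ ∃ g ∈ L, ∃ x ∈ C, ∃ y ∈ C, 0 < g.weight x y

theorem mem_positivePairs {A : OnlineAlgorithm U} {M : ℚ} {G : ASHG U} {σ : G.Order} {i : ℕ}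
    (hi : i ≤ G.agents.card) {C : Finset U} :
    C ∈ A.positivePairs M (G.inputSeq σ i) ↔ ∃ k ≤ i, C ∈ A.run ((G.penalize M).inputSeq σ k) ∧
      C.card = 2 ∧ ∃ x ∈ C, ∃ y ∈ C, 0 < G.weight x y := by
  simp only [positivePairs, mem_biUnion, mem_range, ASHG.length_inputSeq, mem_filter]
  constructor
  · rintro ⟨k, hk, hC, hc, g, hg, x, hx, y, hy, hw⟩
    have hki : k ≤ i := by omega
    rw [G.take_inputSeq σ hki, ← ASHG.inputSeq_penalize] at hC
    obtain ⟨l, -, rfl⟩ := List.mem_map.1 hg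
    refine ⟨k, hki, hC, hc, x, hx, y, hy, ?_⟩
    simp only [ASHG.induce] at hw
    split_ifs at hw with h
    · exact hw
    · exact absurd hw (lt_irrefl _)
  · rintro ⟨k, hki, hC, hc, x, hx, y, hy, hw⟩
    have hs := (A.isPartitionOf (G.penalize M) σ k (hki.trans hi)).subset hC
    refine ⟨k, by omega, ?_, hc, ?_⟩
    · rwa [G.take_inputSeq σ hki, ← ASHG.inputSeq_penalize]
    -- Positivity must be visible in a revealed game. The partition after `k` steps only involves
    -- agents of the `k`-th one, and for `k = 0` there are none.
    · obtain _ | k := k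
      · have h : x ∈ G.arrived σ 0 := hs hx
        rw [ASHG.arrived_zero] at h
        simp at h
      · refine ⟨G.induce (G.arrived σ (k + 1)), List.mem_map.2 ⟨k, List.mem_range.2 hki, rfl⟩,
          x, hx, y, hy, ?_⟩
        have h1 : x ∈ G.arrived σ (k + 1) := hs hx
        have h2 : y ∈ G.arrived σ (k + 1) := hs hy
        simpa [ASHG.induce, h1, h2] using hw

/-- If pairs formed at two times share an agent, the earlier one is contained in the later one, and
equal sizes force equality. A pair that `A` later enlarges is thus kept without conflict. -/
theorem isPairSet_positivePairs (A : OnlineAlgorithm U) (M : ℚ) {G : ASHG U} (σ : G.Order)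
    {i : ℕ} (hi : i ≤ G.agents.card) :
    IsPairSet (G.arrived σ i) (A.positivePairs M (G.inputSeq σ i)) := by
  have key : ∀ k ≤ i, ∀ l ≤ i, k ≤ l → ∀ C ∈ A.run ((G.penalize M).inputSeq σ k),
      ∀ D ∈ A.run ((G.penalize M).inputSeq σ l), C.card = 2 → D.card = 2 →
      ∀ x, x ∈ C → x ∈ D → C = D := by
    intro k _ l hl hkl C hC D hD hc hd x hxC hxD
    exact eq_of_subset_of_card_le
      (A.subset_of_mem_run (G := G.penalize M) (σ := σ) hkl (hl.trans hi) hC hD hxC hxD)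
      (by rw [hc, hd])
  refine ⟨fun C hC => ?_, fun C hC D hD x hxC hxD => ?_⟩
  · obtain ⟨k, hki, hC, hc, -⟩ := (mem_positivePairs hi).1 hC
    exact ⟨((A.isPartitionOf (G.penalize M) σ k (hki.trans hi)).subset hC).trans
      (G.arrived_mono σ hki), hc⟩
  · obtain ⟨k, hki, hC, hc, -⟩ := (mem_positivePairs hi).1 hC
    obtain ⟨l, hli, hD, hd, -⟩ := (mem_positivePairs hi).1 hD
    rcases le_total k l with h | h
    · exact key k hki l hli h C hC D hD hc hd x hxC hxD
    · exact (key l hli k hki h D hD C hC hd hc x hxD hxC).symm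

/-- The online matching algorithm that simulates `A` on the penalized games and keeps the pairs of
positive weight. -/
noncomputable def matchingOf (A : OnlineAlgorithm U) (M : ℚ) : OnlineAlgorithm U where
  run L := pairing ((L.getLast?.map ASHG.agents).getD ∅) (A.positivePairs M L)
  isPartitionOf G σ i hi := by
    rw [G.agents_getLast?_inputSeq]
    exact (A.isPairSet_positivePairs M σ hi).isPartitionOf_pairing
  irrevocable G σ i := by
    rw [G.agents_getLast?_inputSeq, G.agents_getLast?_inputSeq, G.arrived_succ]
    refine removeAgent_pairing (G.notMem_arrived σ i) ?_ fun C => ?_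
    · rw [← G.arrived_succ]
      exact A.isPairSet_positivePairs M σ i.2
    · rw [mem_positivePairs i.2, mem_positivePairs i.2.le]
      constructor
      · rintro ⟨k, hk, hC, h⟩
        refine ⟨⟨k, by omega, hC, h⟩, fun hv => G.notMem_arrived σ i ?_⟩
        exact G.arrived_mono σ hk
          ((A.isPartitionOf (G.penalize M) σ k (hk.trans i.2.le)).subset hC hv)
      · rintro ⟨⟨k, hk, hC, h⟩, hv⟩
        -- A pair of the newest partition that avoids the new agent was already present one step
        -- earlier.
        rcases Nat.lt_or_ge i k with hik | hik
        · obtain rfl : k = i + 1 := by omega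
          refine ⟨i, le_rfl, ?_, h⟩
          have := A.irrevocable (G.penalize M) σ i
          rw [← this, mem_removeAgent]
          exact ⟨⟨C, hC, erase_eq_of_notMem hv⟩, card_pos.1 (by rw [h.1]; norm_num)⟩
        · exact ⟨k, hik, hC, h⟩

theorem matchingOf_run (A : OnlineAlgorithm U) (M : ℚ) (G : ASHG U) (σ : G.Order) (i : ℕ) :
    (A.matchingOf M).run (G.inputSeq σ i) =
      pairing (G.arrived σ i) (A.positivePairs M (G.inputSeq σ i)) := by
  simp only [matchingOf, G.agents_getLast?_inputSeq]

theorem isMatchingAlgorithm_matchingOf (A : OnlineAlgorithm U) (M : ℚ) :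
    (A.matchingOf M).IsMatchingAlgorithm := by
  intro G σ i hi
  rw [matchingOf_run]
  exact (A.isPairSet_positivePairs M σ hi).isMatching_pairing

end OnlineAlgorithm

/-! ### Comparing values and optima of the original and the penalized game -/

namespace ASHG

variable {U : Type*} [DecidableEq U]

/-- `C` is an edge of positive weight. -/
def IsPositivePair {U : Type*} (G : ASHG U) (C : Finset U) : Prop :=
  C.card = 2 ∧ ∃ x ∈ C, ∃ y ∈ C, 0 < G.weight x y

theorem IsPositivePair.exists_eq {G : ASHG U} {C : Finset U} (h : G.IsPositivePair C) :
    ∃ x y, x ≠ y ∧ 0 < G.weight x y ∧ C = {x, y} := by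
  obtain ⟨hc, x, hx, y, hy, hw⟩ := h
  have hxy := (mem_agents_of_weight_pos hw).2.2
  refine ⟨x, y, hxy, hw, (eq_of_subset_of_card_le ?_ ?_).symm⟩
  · intro z hz
    rcases mem_insert.1 hz with rfl | hz
    · exact hx
    · rwa [mem_singleton.1 hz]
  · rw [hc, card_pair hxy]

theorem IsPositivePair.value_pos {G : ASHG U} {C : Finset U} (h : G.IsPositivePair C) :
    0 < G.value C := by
  obtain ⟨x, y, hxy, hw, rfl⟩ := h.exists_eq
  rw [value_pair G hxy]
  linarith

theorem IsPositivePair.value_penalize (M : ℚ) {G : ASHG U} {C : Finset U}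
    (h : G.IsPositivePair C) : (G.penalize M).value C = G.value C := by
  obtain ⟨x, y, hxy, hw, rfl⟩ := h.exists_eq
  rw [value_pair _ hxy, value_pair _ hxy, penalize_weight_of_pos hw]

theorem exists_nonpos_weight {G : ASHG U} (hG : G.positiveGraph.IsAcyclic) {C : Finset U}
    (hc : 2 ≤ C.card) (h : ¬ G.IsPositivePair C) :
    ∃ x ∈ C, ∃ y ∈ C, x ≠ y ∧ G.weight x y ≤ 0 := by
  by_contra hn
  push Not at hn
  rcases hc.lt_or_eq with hc | hc
  · refine hG.cliqueFree hc C ⟨fun x hx y hy hxy => ?_, rfl⟩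
    exact hn x hx y hy hxy
  · obtain ⟨x, y, hxy, rfl⟩ := card_eq_two.1 hc.symm
    exact h ⟨hc.symm, x, by simp, y, by simp, hn x (by simp) y (by simp) hxy⟩

theorem value_penalize_nonpos {G : ASHG U} (hG : G.positiveGraph.IsAcyclic) {M : ℚ}
    (hM : 2 * G.positiveWeight ≤ M) {C : Finset U} (hC : C ⊆ G.agents)
    (h : ¬ G.IsPositivePair C) : (G.penalize M).value C ≤ 0 := by
  have hp : 2 * G.positiveWeight = ∑ x ∈ G.agents, ∑ y ∈ G.agents, max (G.weight x y) 0 := by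
    rw [positiveWeight]
    ring
  have hM0 : 0 ≤ M := (hp ▸ sum_nonneg fun x _ => sum_nonneg fun y _ => le_max_right _ _).trans hM
  rcases Nat.lt_or_ge C.card 2 with hc | hc
  · rcases Nat.le_one_iff_eq_zero_or_eq_one.1 (Nat.lt_succ_iff.1 hc) with hc | hc
    · simp [card_eq_zero.1 hc, value]
    · obtain ⟨x, rfl⟩ := card_eq_one.1 hc
      exact (value_singleton _ x).le
  · obtain ⟨a, ha, b, hb, hab, hw⟩ := exists_nonpos_weight hG hc h
    -- The penalty is charged at the ordered pair `(a, b)` only. One copy of `M` suffices, because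
    -- `M` dominates the positive weight summed over ordered pairs.
    have hle : ∀ x y, (G.penalize M).weight x y ≤
        max (G.weight x y) 0 - if x = a then (if y = b then M else 0) else 0 := by
      intro x y
      split_ifs with hx hy
      · subst hx hy
        simp only [penalize]
        rw [if_pos ⟨hC ha, hC hb, hab⟩, if_neg hw.not_gt]
        linarith [le_max_right (G.weight x y) 0]
      all_goals
        simp only [penalize]
        split_ifs
        · simp
        · linarith [le_max_right (G.weight x y) 0]
        · simp
    calc (G.penalize M).value C
        ≤ ∑ x ∈ C, ∑ y ∈ C, (max (G.weight x y) 0 -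
            if x = a then (if y = b then M else 0) else 0) :=
          sum_le_sum fun x _ => sum_le_sum fun y _ => hle x y
      _ = ∑ x ∈ C, ∑ y ∈ C, max (G.weight x y) 0 - M := by
          simp only [sum_sub_distrib]
          rw [sum_eq_single_of_mem (f := fun x => ∑ y ∈ C, if x = a then (if y = b then M else 0)
            else 0) a ha (fun x _ hx => by simp [hx])]
          simp [hb]
      _ ≤ ∑ x ∈ G.agents, ∑ y ∈ G.agents, max (G.weight x y) 0 - M := by
          gcongr
          refine (sum_le_sum fun x _ => sum_le_sum_of_subset_of_nonneg hC fun y _ _ =>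
            le_max_right _ _).trans (sum_le_sum_of_subset_of_nonneg hC fun x _ _ =>
              sum_nonneg fun y _ => le_max_right _ _)
      _ ≤ 0 := by linarith

theorem IsPartitionOf.isPairSet_filter {N : Finset U} {π : Finset (Finset U)}
    (h : IsPartitionOf π N) (p : Finset U → Prop) [DecidablePred p]
    (hp : ∀ C, p C → C.card = 2) : IsPairSet N (π.filter p) :=
  ⟨fun _ hC => ⟨h.subset (mem_filter.1 hC).1, hp _ (mem_filter.1 hC).2⟩,
    fun _ hC _ hD _ hxC hxD => h.eq_of_mem (mem_filter.1 hC).1 (mem_filter.1 hD).1 hxC hxD⟩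

theorem socialWelfare_le_optWelfare {G : ASHG U} {π : Finset (Finset U)}
    (h : IsPartitionOf π G.agents) : G.socialWelfare π ≤ G.optWelfare := by
  obtain ⟨P, rfl⟩ := h
  exact le_sup' (fun P : Finpartition G.agents => G.socialWelfare P.parts) (mem_univ P)

theorem socialWelfare_le_optMatchingWelfare {G : ASHG U} {π : Finset (Finset U)}
    (h : IsPartitionOf π G.agents) (hm : IsMatching π) :
    G.socialWelfare π ≤ G.optMatchingWelfare := by
  obtain ⟨P, rfl⟩ := h
  exact le_sup' (fun P : Finpartition G.agents => G.socialWelfare P.parts)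
    (mem_filter.2 ⟨mem_univ P, hm⟩)

theorem optMatchingWelfare_nonneg (G : ASHG U) : 0 ≤ G.optMatchingWelfare := by
  have h : IsPairSet G.agents ∅ := by simp [IsPairSet]
  have := socialWelfare_le_optMatchingWelfare h.isPartitionOf_pairing h.isMatching_pairing
  rwa [socialWelfare_pairing h, sum_empty] at this

theorem value_nonpos_of_not_isPositivePair {U : Type*} {G : ASHG U} {C : Finset U} (hc : C.card ≤ 2)
    (h : ¬ G.IsPositivePair C) : G.value C ≤ 0 := by
  rcases hc.lt_or_eq with hc | hc
  · refine sum_nonpos fun x hx => sum_nonpos fun y hy => ?_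
    rw [card_le_one.1 (Nat.lt_succ_iff.1 hc) x hx y hy, weight_self]
  · refine sum_nonpos fun x hx => sum_nonpos fun y hy => ?_
    by_contra hw
    exact h ⟨hc, x, hx, y, hy, not_le.1 hw⟩

/-- Dissolving the pairs of nonpositive weight does not lower the welfare of a matching, and the
remaining pairs have the same value in both games. -/
theorem optMatchingWelfare_le_optWelfare_penalize (G : ASHG U) (M : ℚ) :
    G.optMatchingWelfare ≤ (G.penalize M).optWelfare := by
  classical
  refine sup'_le _ _ fun P hP => ?_
  have hP := (mem_filter.1 hP).2
  have hpart : IsPartitionOf P.parts G.agents := ⟨P, rfl⟩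
  have hpair := IsPartitionOf.isPairSet_filter hpart G.IsPositivePair fun C h => h.1
  calc G.socialWelfare P.parts = ∑ C ∈ P.parts, G.value C := socialWelfare_eq_sum_value hpart
    _ ≤ ∑ C ∈ P.parts.filter G.IsPositivePair, G.value C := by
      rw [sum_filter]
      refine sum_le_sum fun C hC => ?_
      split_ifs with h
      · exact le_rfl
      · exact value_nonpos_of_not_isPositivePair (hP C hC) h
    _ = ∑ C ∈ P.parts.filter G.IsPositivePair, (G.penalize M).value C :=
      sum_congr rfl fun C hC => ((mem_filter.1 hC).2.value_penalize M).symm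
    _ = (G.penalize M).socialWelfare (pairing (G.penalize M).agents
          (P.parts.filter G.IsPositivePair)) :=
      (socialWelfare_pairing (G := G.penalize M) hpair).symm
    _ ≤ _ := socialWelfare_le_optWelfare (G := G.penalize M) hpair.isPartitionOf_pairing

end ASHG

/-! ### The reduction to matchings on the tree domain -/

namespace OnlineAlgorithm

variable {U : Type*} [DecidableEq U]

theorem matchingOf_output (A : OnlineAlgorithm U) (M : ℚ) (G : ASHG U) (σ : G.Order) :
    (A.matchingOf M).output G σ =
      pairing G.agents (A.positivePairs M (G.inputSeq σ G.agents.card)) := by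
  rw [output, matchingOf_run, G.arrived_card]

theorem isPairSet_positivePairs_card (A : OnlineAlgorithm U) (M : ℚ) (G : ASHG U)
    (σ : G.Order) :
    IsPairSet G.agents (A.positivePairs M (G.inputSeq σ G.agents.card)) := by
  have := A.isPairSet_positivePairs M σ le_rfl
  rwa [G.arrived_card] at this

theorem isPositivePair_of_mem_positivePairs {A : OnlineAlgorithm U} {M : ℚ} {G : ASHG U}
    {σ : G.Order} {C : Finset U} (hC : C ∈ A.positivePairs M (G.inputSeq σ G.agents.card)) :
    G.IsPositivePair C := by
  obtain ⟨k, -, -, h⟩ := (mem_positivePairs le_rfl).1 hC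
  exact h

theorem socialWelfare_matchingOf_nonneg (A : OnlineAlgorithm U) (M : ℚ) (G : ASHG U)
    (σ : G.Order) : 0 ≤ G.socialWelfare ((A.matchingOf M).output G σ) := by
  rw [matchingOf_output, ASHG.socialWelfare_pairing (A.isPairSet_positivePairs_card M G σ)]
  exact sum_nonneg fun C hC => (isPositivePair_of_mem_positivePairs hC).value_pos.le

/-- The positive pairs in the final partition of `A` are all kept, its other coalitions contribute
nothing positive, and the kept pairs that `A` enlarged later only add welfare. -/
theorem socialWelfare_penalize_le (A : OnlineAlgorithm U) {M : ℚ} {G : ASHG U}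
    (hG : G.positiveGraph.IsAcyclic) (hM : 2 * G.positiveWeight ≤ M) (σ : G.Order) :
    (G.penalize M).socialWelfare (A.output (G.penalize M) σ) ≤
      G.socialWelfare ((A.matchingOf M).output G σ) := by
  classical
  have hpart := A.isPartitionOf_output (G.penalize M) σ
  rw [matchingOf_output, ASHG.socialWelfare_pairing (A.isPairSet_positivePairs_card M G σ),
    ASHG.socialWelfare_eq_sum_value hpart]
  calc ∑ C ∈ A.output (G.penalize M) σ, (G.penalize M).value C
      ≤ ∑ C ∈ (A.output (G.penalize M) σ).filter G.IsPositivePair, G.value C := by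
        rw [sum_filter]
        refine sum_le_sum fun C hC => ?_
        split_ifs with h
        · exact (h.value_penalize M).le
        · exact ASHG.value_penalize_nonpos hG hM (hpart.subset hC) h
    _ ≤ _ := by
        refine sum_le_sum_of_subset_of_nonneg (fun C hC => ?_)
          fun C hC _ => (isPositivePair_of_mem_positivePairs hC).value_pos.le
        rw [mem_filter] at hC
        exact (mem_positivePairs le_rfl).2 ⟨_, le_rfl, hC.1, hC.2⟩

theorem expectedWelfare_congr {A B : OnlineAlgorithm U} {G : ASHG U}
    (h : ∀ σ : G.Order, A.output G σ = B.output G σ) :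
    A.expectedWelfare G = B.expectedWelfare G := by
  simp only [expectedWelfare, h]

theorem expectedWelfare_le {A : OnlineAlgorithm U} {G : ASHG U} {b : ℚ}
    (h : ∀ σ : G.Order, G.socialWelfare (A.output G σ) ≤ b) : A.expectedWelfare G ≤ b := by
  have hpos : (0 : ℚ) < Fintype.card G.Order := by
    have : Nonempty G.Order := ⟨G.agents.equivFin.symm⟩
    exact_mod_cast Fintype.card_pos
  rw [expectedWelfare, div_le_iff₀ hpos]
  calc _ ≤ ∑ σ : G.Order, b := sum_le_sum fun σ _ => h σ
    _ = b * _ := by rw [sum_const, card_univ, nsmul_eq_mul, mul_comm]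

theorem exists_isCompetitiveMatchingOn (A : OnlineAlgorithm U) {c : ℝ} (hc : c ≤ 1)
    (hA : A.IsCompetitive c) :
    ∃ B : OnlineAlgorithm U, B.IsCompetitiveMatchingOn (ASHG.treeDomain U) c := by
  obtain ⟨B, hB⟩ := exists_limit fun M => A.matchingOf M
  refine ⟨B, fun G σ i hi => ?_, fun G hG => ?_⟩
  · obtain ⟨M, hM⟩ := (hB G).exists
    rw [hM σ i hi]
    exact A.isMatchingAlgorithm_matchingOf M G σ i hi
  obtain ⟨m, hm⟩ := exists_nat_ge (2 * G.positiveWeight)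
  have hlarge : ∀ᶠ M in (Filter.hyperfilter ℕ : Filter ℕ), m ≤ M :=
    Filter.Eventually.filter_mono (Nat.hyperfilter_le_atTop) (Filter.eventually_ge_atTop m)
  obtain ⟨M, hBM, hmM⟩ := ((hB G).and hlarge).exists
  have hM : 2 * G.positiveWeight ≤ M := hm.trans (by exact_mod_cast hmM)
  rw [expectedWelfare_congr (B := A.matchingOf M) fun σ => hBM σ _ le_rfl]
  have h1 : A.expectedWelfare (G.penalize M) ≤ (A.matchingOf M).expectedWelfare G :=
    div_le_div_of_nonneg_right
      (sum_le_sum fun σ _ => A.socialWelfare_penalize_le hG.1 hM σ) (Nat.cast_nonneg _)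
  have h2 : (A.matchingOf M).expectedWelfare G ≤ G.optMatchingWelfare := by
    refine expectedWelfare_le fun σ => ?_
    refine ASHG.socialWelfare_le_optMatchingWelfare ((A.matchingOf M).isPartitionOf_output G σ) ?_
    exact A.isMatchingAlgorithm_matchingOf M G σ _ le_rfl
  have h3 : 0 ≤ (A.matchingOf M).expectedWelfare G :=
    div_nonneg (sum_nonneg fun σ _ => A.socialWelfare_matchingOf_nonneg M G σ)
      (Nat.cast_nonneg _)
  have h4 := G.optMatchingWelfare_le_optWelfare_penalize M
  have hcA := hA (G.penalize M)
  rw [welfareRatio] at hcA ⊢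
  -- If the optimum is `0`, the expected welfare is squeezed to `0` and the ratio is `1` by
  -- convention; this is where `c ≤ 1` enters.
  by_cases h0 : G.optMatchingWelfare = 0
  · rw [if_pos h0, if_pos (le_antisymm (h2.trans h0.le) h3)]
    exact hc
  · have hpos := lt_of_le_of_ne G.optMatchingWelfare_nonneg (Ne.symm h0)
    have hpos' := hpos.trans_le h4
    rw [if_neg hpos'.ne'] at hcA
    rw [if_neg h0]
    rify at h1 h3 h4 hpos hpos'
    rw [le_div_iff₀ hpos'] at hcA
    -- For negative `c`, multiplying the comparison of optima by `c` would reverse it; nonnegativity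
    -- of the welfare suffices instead.
    rcases le_total c 0 with hc0 | hc0
    · exact hc0.trans (div_nonneg h3 hpos.le)
    · rw [le_div_iff₀ hpos]
      nlinarith

end OnlineAlgorithm

/-! ### Uniformly random orders as lists -/

section Orders

variable {U : Type*} [DecidableEq U]

/-- The orders of a finite set, as lists without repetition. -/
def orders {U : Type*} (S : Finset U) : Finset (List U) := ⟨S.val.lists, Multiset.lists_nodup_finset S⟩

theorem mem_orders {S : Finset U} {l : List U} : l ∈ orders S ↔ l.Nodup ∧ l.toFinset = S := by
  rw [orders, mem_mk, Multiset.mem_lists_iff, Multiset.quot_mk_to_coe]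
  constructor
  · intro h
    have hn : l.Nodup := by
      rw [← Multiset.coe_nodup, ← h]
      exact S.nodup
    exact ⟨hn, by ext x; rw [List.mem_toFinset, ← Multiset.mem_coe, ← h, mem_val]⟩
  · rintro ⟨hn, rfl⟩
    rw [List.toFinset_val, hn.dedup]

theorem cons_mem_orders {S : Finset U} {v : U} {l : List U} :
    v :: l ∈ orders S ↔ v ∈ S ∧ l ∈ orders (S.erase v) := by
  simp only [mem_orders, List.nodup_cons, List.toFinset_cons]
  constructor
  · rintro ⟨⟨hv, hn⟩, rfl⟩
    exact ⟨mem_insert_self _ _, hn, by rw [erase_insert (by simpa using hv)]⟩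
  · rintro ⟨hv, hn, hl⟩
    refine ⟨⟨?_, hn⟩, by rw [hl, insert_erase hv]⟩
    rw [← List.mem_toFinset, hl]
    simp

theorem sum_orders {S : Finset U} (hS : S.Nonempty) {R : Type*} [AddCommMonoid R]
    (F : List U → R) :
    ∑ l ∈ orders S, F l = ∑ v ∈ S, ∑ l ∈ orders (S.erase v), F (v :: l) := by
  rw [sum_sigma']
  symm
  refine sum_bij (fun p _ => p.1 :: p.2) ?_ ?_ ?_ fun _ _ => rfl
  · rintro ⟨v, l⟩ h
    rw [mem_sigma] at h
    exact cons_mem_orders.2 h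
  · rintro ⟨v, l⟩ - ⟨v', l'⟩ - h
    simp only [List.cons.injEq] at h
    obtain ⟨rfl, rfl⟩ := h
    rfl
  · rintro (_ | ⟨v, l⟩) h
    · have := (mem_orders.1 h).2
      simp only [List.toFinset_nil] at this
      exact absurd this.symm hS.ne_empty
    · exact ⟨⟨v, l⟩, mem_sigma.2 (cons_mem_orders.1 h), rfl⟩

theorem card_orders {U : Type*} (S : Finset U) : (orders S).card = S.card.factorial := by
  rw [orders, card_mk, card_def]
  generalize S.val = s
  induction s using Quotient.inductionOn with
  | h l => simp [Multiset.lists_coe, List.length_permutations]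

/-- The mean of `F` over the orders of `S`. -/
noncomputable def orderMean {U : Type*} (S : Finset U) (F : List U → ℝ) : ℝ :=
  (∑ l ∈ orders S, F l) / (orders S).card

theorem card_orders_pos {U : Type*} (S : Finset U) : (0 : ℝ) < (orders S).card := by
  rw [card_orders]
  exact_mod_cast S.card.factorial_pos

theorem orderMean_mono {U : Type*} {S : Finset U} {F F' : List U → ℝ} (h : ∀ l ∈ orders S, F l ≤ F' l) :
    orderMean S F ≤ orderMean S F' :=
  div_le_div_of_nonneg_right (sum_le_sum h) (Nat.cast_nonneg _)

theorem orderMean_congr {U : Type*} {S : Finset U} {F F' : List U → ℝ} (h : ∀ l ∈ orders S, F l = F' l) :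
    orderMean S F = orderMean S F' := by
  rw [orderMean, orderMean, sum_congr rfl h]

theorem orderMean_add {U : Type*} (S : Finset U) (F F' : List U → ℝ) :
    orderMean S (fun l => F l + F' l) = orderMean S F + orderMean S F' := by
  rw [orderMean, orderMean, orderMean, sum_add_distrib, add_div]

theorem orderMean_one_sub {U : Type*} (S : Finset U) (F : List U → ℝ) :
    orderMean S (fun l => 1 - F l) = 1 - orderMean S F := by
  rw [orderMean, orderMean, sum_sub_distrib, sub_div, sum_const, nsmul_eq_mul, mul_one,
    div_self (card_orders_pos S).ne']

/-- The head of the list is the last arrival. It is uniform in `S`, and given its value the other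
agents are in uniformly random order. All recursions for matching probabilities come from this
identity. -/
theorem card_mul_orderMean {S : Finset U} (hS : S.Nonempty) (F : List U → ℝ) :
    S.card * orderMean S F = ∑ v ∈ S, orderMean (S.erase v) fun l => F (v :: l) := by
  have hc : ∀ v ∈ S, ((orders S).card : ℝ) = S.card * (orders (S.erase v)).card := by
    intro v hv
    rw [card_orders, card_orders, card_erase_of_mem hv,
      ← Nat.mul_factorial_pred (card_pos.2 hS).ne']
    push_cast
    ring
  have hS0 : (S.card : ℝ) ≠ 0 := by exact_mod_cast (card_pos.2 hS).ne'
  rw [orderMean, sum_orders hS, sum_div, mul_sum]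
  refine sum_congr rfl fun v hv => ?_
  have := (card_orders_pos (S.erase v)).ne'
  rw [orderMean, hc v hv]
  field_simp

/-- The arrival order `σ` as a list, the latest agent first. -/
def ASHG.orderList {U : Type*} (G : ASHG U) (σ : G.Order) : List U :=
  (List.ofFn fun i => (σ i : U)).reverse

theorem ASHG.orderList_mem_orders (G : ASHG U) (σ : G.Order) :
    G.orderList σ ∈ orders G.agents := by
  rw [mem_orders, orderList, List.nodup_reverse, List.nodup_ofFn]
  refine ⟨Subtype.val_injective.comp σ.injective, ?_⟩
  ext x
  simp only [List.mem_toFinset, List.mem_reverse, List.mem_ofFn]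
  exact ⟨fun ⟨i, hi⟩ => hi ▸ (σ i).2, fun hx => ⟨σ.symm ⟨x, hx⟩, by simp⟩⟩

theorem ASHG.orderList_injective {U : Type*} (G : ASHG U) : Function.Injective G.orderList := by
  intro σ τ h
  have := List.ofFn_injective (List.reverse_injective h)
  ext i
  exact congrFun this i

theorem ASHG.exists_orderList_eq (G : ASHG U) {l : List U} (hl : l ∈ orders G.agents) :
    ∃ σ : G.Order, G.orderList σ = l := by
  have hcard : Fintype.card G.Order = (orders G.agents).card := by
    rw [card_orders, Fintype.card_equiv G.agents.equivFin.symm, Fintype.card_fin]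
  have := surj_on_of_inj_on_of_card_le (s := (univ : Finset G.Order)) (t := orders G.agents)
    (fun σ _ => G.orderList σ) (fun σ _ => G.orderList_mem_orders σ)
    (fun σ τ _ _ h => G.orderList_injective h) (by rw [card_univ, hcard]) l hl
  obtain ⟨σ, -, h⟩ := this
  exact ⟨σ, h.symm⟩

theorem ASHG.sum_order (G : ASHG U) (F : List U → ℝ) :
    (∑ σ : G.Order, F (G.orderList σ)) / Fintype.card G.Order = orderMean G.agents F := by
  rw [orderMean, card_orders, Fintype.card_equiv G.agents.equivFin.symm, Fintype.card_fin]
  congr 1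
  refine sum_bij (fun σ _ => G.orderList σ) (fun σ _ => G.orderList_mem_orders σ)
    (fun σ _ τ _ h => G.orderList_injective h) (fun l hl => ?_) fun _ _ => rfl
  obtain ⟨σ, h⟩ := G.exists_orderList_eq hl
  exact ⟨σ, mem_univ _, h⟩

end Orders

/-! ### Histories of induced subgames -/

namespace ASHG

variable {U : Type*} [DecidableEq U]

/-- The input sequence when the agents of the list `l` have arrived, the latest one first. -/
def history (G : ASHG U) : List U → List (ASHG U)
  | [] => []
  | v :: l => history G l ++ [G.induce (v :: l).toFinset]

theorem induce_induce (G : ASHG U) {S T : Finset U} (h : T ⊆ S) :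
    (G.induce S).induce T = G.induce T := by
  ext x y
  · simp only [induce, mem_inter]
    exact ⟨fun hx => ⟨hx.1.1, hx.2⟩, fun hx => ⟨⟨hx.1, h hx.2⟩, hx.2⟩⟩
  · simp only [induce]
    by_cases hxy : x ∈ T ∧ y ∈ T
    · rw [if_pos hxy, if_pos ⟨h hxy.1, h hxy.2⟩, if_pos hxy]
    · rw [if_neg hxy, if_neg hxy]

theorem toFinset_take_ofFn (G : ASHG U) (σ : G.Order) (i : ℕ) :
    ((List.ofFn fun i => (σ i : U)).take i).reverse.toFinset = G.arrived σ i := by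
  ext x
  simp only [List.toFinset_reverse, List.mem_toFinset, List.mem_take_iff_getElem, arrived,
    mem_image, mem_filter, mem_univ, true_and, List.length_ofFn, List.getElem_ofFn]
  constructor
  · rintro ⟨k, hk, rfl⟩
    exact ⟨⟨k, (lt_min_iff.1 hk).2⟩, (lt_min_iff.1 hk).1, rfl⟩
  · rintro ⟨k, hk, rfl⟩
    exact ⟨k, lt_min_iff.2 ⟨hk, k.2⟩, rfl⟩

/-- An algorithm cannot distinguish a prefix of a run on `G` from a run on the induced subgame.
Hence its guarantees for all subgames constrain the same family of decisions. -/
theorem inputSeq_induce_eq_history (G : ASHG U) (S : Finset U) (σ : (G.induce S).Order) {i : ℕ}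
    (hi : i ≤ (G.induce S).agents.card) :
    (G.induce S).inputSeq σ i = G.history ((List.ofFn fun i => (σ i : U)).take i).reverse := by
  induction i with
  | zero => simp [inputSeq, history]
  | succ i ih =>
    have h : ((List.ofFn fun i => (σ i : U)).take (i + 1)).reverse =
        (σ ⟨i, hi⟩ : U) :: ((List.ofFn fun i => (σ i : U)).take i).reverse := by
      rw [List.take_succ_eq_append_getElem (by simpa using hi)]
      simp
    rw [inputSeq_succ, ih (by omega), h, history, ← h, toFinset_take_ofFn,
      induce_induce]
    exact ((G.induce S).arrived_subset σ _).trans inter_subset_right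

end ASHG

/-- The matchings `μ l` arise online while the agents of the list `l` arrive, the latest agent
first, as long as all of them belong to `N`. -/
structure IsOnlineMatching {U : Type*} [DecidableEq U] (N : Finset U)
    (μ : List U → Finset (Finset U)) : Prop where
  isPartitionOf : ∀ S ⊆ N, ∀ l ∈ orders S, IsPartitionOf (μ l) S
  isMatching : ∀ S ⊆ N, ∀ l ∈ orders S, IsMatching (μ l)
  removeAgent_eq : ∀ S ⊆ N, ∀ v l, v :: l ∈ orders S → removeAgent (μ (v :: l)) v = μ l

/-! ### Recursions for matching probabilities -/

section Probabilities

variable {U : Type*} [DecidableEq U]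

open Classical in
/-- The probability that `x` and `y` are matched when the agents of `S` have arrived. -/
noncomputable def pairProb (μ : List U → Finset (Finset U)) (S : Finset U) (x y : U) : ℝ :=
  orderMean S fun l => if {x, y} ∈ μ l then 1 else 0

open Classical in
/-- The probability that `x` is matched when the agents of `S` have arrived. -/
noncomputable def matchProb (μ : List U → Finset (Finset U)) (S : Finset U) (x : U) : ℝ :=
  orderMean S fun l => if ∃ z, z ≠ x ∧ {x, z} ∈ μ l then 1 else 0

open Classical in
/-- The probability that `x` and `y` are matched when the agents of `S` have arrived, given that
`y` has arrived last. -/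
noncomputable def lastProb (μ : List U → Finset (Finset U)) (S : Finset U) (x y : U) : ℝ :=
  orderMean (S.erase y) fun l => if {x, y} ∈ μ (y :: l) then 1 else 0

namespace IsOnlineMatching

variable {N : Finset U} {μ : List U → Finset (Finset U)}

theorem pair_mem_cons (h : IsOnlineMatching N μ) {S : Finset U} (hS : S ⊆ N) {v : U} {l : List U}
    (hl : v :: l ∈ orders S) {x y : U} (hxy : x ≠ y) (hm : {x, y} ∈ μ l) :
    {x, y} ∈ μ (v :: l) := by
  rw [← h.removeAgent_eq S hS v l hl, mem_removeAgent] at hm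
  obtain ⟨⟨C, hC, hCv⟩, -⟩ := hm
  have hle : C.card ≤ ({x, y} : Finset U).card := by
    rw [card_pair hxy]
    exact h.isMatching S hS _ hl C hC
  rwa [eq_of_subset_of_card_le (hCv ▸ erase_subset v C) hle]

theorem pair_mem_cons_iff (h : IsOnlineMatching N μ) {S : Finset U} (hS : S ⊆ N) {v : U}
    {l : List U} (hl : v :: l ∈ orders S) {x y : U} (hxy : x ≠ y) (hvx : v ≠ x) (hvy : v ≠ y) :
    {x, y} ∈ μ (v :: l) ↔ {x, y} ∈ μ l := by
  refine ⟨fun hm => ?_, h.pair_mem_cons hS hl hxy⟩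
  rw [← h.removeAgent_eq S hS v l hl, mem_removeAgent]
  exact ⟨⟨_, hm, erase_eq_of_notMem (by simp [hvx, hvy])⟩, by simp⟩

/-- A pair in a matching cannot grow or be dissolved, so `x` can be matched to the newcomer only if
it was free before. -/
theorem not_matched_of_pair_mem_cons (h : IsOnlineMatching N μ) {S : Finset U} (hS : S ⊆ N)
    {x y : U} {l : List U} (hl : y :: l ∈ orders S) (hm : {x, y} ∈ μ (y :: l)) :
    ¬ ∃ z, z ≠ x ∧ {x, z} ∈ μ l := by
  rintro ⟨z, hzx, hz⟩
  have hz' := h.pair_mem_cons hS hl hzx.symm hz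
  have heq := (h.isPartitionOf S hS _ hl).eq_of_mem hm hz' (x := x) (by simp) (by simp)
  have hy : y ∈ S.erase y := by
    refine (h.isPartitionOf _ ((erase_subset _ _).trans hS) l (cons_mem_orders.1 hl).2).subset hz ?_
    rw [← heq]
    simp
  simp at hy

theorem pairProb_le_matchProb {S : Finset U} {x y : U} (hxy : x ≠ y) :
    pairProb μ S x y ≤ matchProb μ S x := by
  refine orderMean_mono fun l _ => ?_
  split_ifs with h1 h2
  · exact le_rfl
  · exact absurd ⟨y, hxy.symm, h1⟩ h2
  · exact zero_le_one
  · exact le_rfl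

theorem sum_eq_add_add {S : Finset U} {x y : U} (hxy : x ≠ y) (hx : x ∈ S) (hy : y ∈ S)
    (F : U → ℝ) : ∑ v ∈ S, F v = ∑ v ∈ (S.erase x).erase y, F v + F y + F x := by
  rw [sum_erase_add _ _ (mem_erase.2 ⟨hxy.symm, hy⟩), sum_erase_add _ _ hx]

theorem card_mul_pairProb (h : IsOnlineMatching N μ) {S : Finset U} (hS : S ⊆ N) {x y : U}
    (hxy : x ≠ y) (hx : x ∈ S) (hy : y ∈ S) :
    S.card * pairProb μ S x y = ∑ v ∈ (S.erase x).erase y, pairProb μ (S.erase v) x y +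
      lastProb μ S x y + lastProb μ S y x := by
  rw [pairProb, card_mul_orderMean ⟨x, hx⟩, sum_eq_add_add hxy hx hy]
  congr 1
  · congr 1
    refine sum_congr rfl fun v hv => orderMean_congr fun l hl => ?_
    simp only [mem_erase] at hv
    have := h.pair_mem_cons_iff hS (cons_mem_orders.2 ⟨hv.2.2, hl⟩) hxy hv.2.1 hv.1
    simp only [this]
  · rw [lastProb, pair_comm]

theorem lastProb_le (h : IsOnlineMatching N μ) {S : Finset U} (hS : S ⊆ N) {x y : U}
    (hy : y ∈ S) : lastProb μ S x y ≤ 1 - matchProb μ (S.erase y) x := by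
  rw [matchProb, ← orderMean_one_sub]
  refine orderMean_mono fun l hl => ?_
  have := h.not_matched_of_pair_mem_cons (x := x) hS (cons_mem_orders.2 ⟨hy, hl⟩)
  split_ifs with h1 h2 <;> simp_all

/-- The terms belong to the possible last arrivals. When `y` is last, the events that `x` was
matched before and that `x` is now matched to `y` are disjoint, so their probabilities add up. -/
theorem le_card_mul_matchProb (h : IsOnlineMatching N μ) {S : Finset U} (hS : S ⊆ N) {x y : U}
    (hxy : x ≠ y) (hx : x ∈ S) (hy : y ∈ S) :
    ∑ v ∈ (S.erase x).erase y, matchProb μ (S.erase v) x + (matchProb μ (S.erase y) x +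
      lastProb μ S x y) + lastProb μ S y x ≤ S.card * matchProb μ S x := by
  classical
  have hdef : matchProb μ S x =
    orderMean S fun l => if ∃ z, z ≠ x ∧ {x, z} ∈ μ l then 1 else 0 := rfl
  rw [hdef, card_mul_orderMean ⟨x, hx⟩, sum_eq_add_add hxy hx hy]
  refine add_le_add (add_le_add (sum_le_sum fun v hv => orderMean_mono fun l hl => ?_) ?_) ?_
  · simp only [mem_erase] at hv
    have : (∃ z, z ≠ x ∧ {x, z} ∈ μ l) → ∃ z, z ≠ x ∧ {x, z} ∈ μ (v :: l) :=
      fun ⟨z, hz, hm⟩ => ⟨z, hz, h.pair_mem_cons hS (cons_mem_orders.2 ⟨hv.2.2, hl⟩) hz.symm hm⟩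
    split_ifs with h1 h2
    · exact le_rfl
    · exact absurd (this h1) h2
    · exact zero_le_one
    · exact le_rfl
  · rw [matchProb, lastProb, ← orderMean_add]
    refine orderMean_mono fun l hl => ?_
    have hl' := cons_mem_orders.2 ⟨hy, hl⟩
    have h1 := h.not_matched_of_pair_mem_cons (x := x) hS hl'
    have h2 : (∃ z, z ≠ x ∧ {x, z} ∈ μ l) → ∃ z, z ≠ x ∧ {x, z} ∈ μ (y :: l) :=
      fun ⟨z, hz, hm⟩ => ⟨z, hz, h.pair_mem_cons hS hl' hz.symm hm⟩
    have h3 : {x, y} ∈ μ (y :: l) → ∃ z, z ≠ x ∧ {x, z} ∈ μ (y :: l) :=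
      fun hm => ⟨y, hxy.symm, hm⟩
    by_cases hq : {x, y} ∈ μ (y :: l)
    · rw [if_neg (h1 hq), if_pos hq, if_pos (h3 hq), zero_add]
    · rw [if_neg hq, add_zero]
      split_ifs with h4 h5
      · exact le_rfl
      · exact absurd (h2 h4) h5
      · exact zero_le_one
      · exact le_rfl
  · refine orderMean_mono fun l hl => ?_
    have h3 : {y, x} ∈ μ (x :: l) → ∃ z, z ≠ x ∧ {x, z} ∈ μ (x :: l) :=
      fun hm => ⟨y, hxy.symm, by rwa [pair_comm]⟩
    split_ifs with h4 h5
    · exact le_rfl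
    · exact absurd (h3 h4) h5
    · exact zero_le_one
    · exact le_rfl

/-- If the center `x` of a star with leaves in `A` is always matched to the leaf of largest rank with
probability at least `c`, then `x` is matched with a probability that is larger by almost `c`. -/
theorem add_pairProb_le_matchProb (h : IsOnlineMatching N μ) {T A : Finset U} (hT : T ⊆ N) {x : U}
    (hxA : x ∉ A) {ρ : U → ℕ} (hρ : Set.InjOn ρ A) {c : ℝ}
    (hc : ∀ S ⊆ T, x ∈ S → ∀ y ∈ S ∩ A, (∀ z ∈ S ∩ A, z ≠ y → ρ z < ρ y) →
      c ≤ pairProb μ S x y)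
    {S : Finset U} (hS : S ⊆ T) (hx : x ∈ S) {y : U} (hy : y ∈ S ∩ A)
    (hmax : ∀ z ∈ S ∩ A, z ≠ y → ρ z < ρ y) :
    c * ((S ∩ A).card - 1) / ((S ∩ A).card + 1) + pairProb μ S x y ≤ matchProb μ S x := by
  induction hn : S.card using Nat.strong_induction_on generalizing S y with
  | _ n ih =>
  obtain ⟨hyS, hyA⟩ := mem_inter.1 hy
  have hxy : x ≠ y := fun e => hxA (e ▸ hyA)
  set k := (S ∩ A).card with hk
  have hk1 : 1 ≤ k := card_pos.2 ⟨y, hy⟩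
  rcases hk1.eq_or_lt with hk1 | hk2
  · rw [← hk1]
    simpa using pairProb_le_matchProb hxy
  have hcard : ∀ v ∈ S, (S.erase v).card < n := fun v hv => hn ▸ card_erase_lt_of_mem hv
  have hsub : ∀ v, S.erase v ⊆ T := fun v => (erase_subset _ _).trans hS
  have hA : ∀ v ∈ S ∩ A, (((S.erase v) ∩ A).card : ℝ) = k - 1 := by
    intro v hv
    rw [erase_inter, card_erase_of_mem hv, Nat.cast_sub hk2.le, Nat.cast_one]
  have hnA : ∀ v, v ∉ A → ((S.erase v) ∩ A).card = k := by
    intro v hv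
    rw [erase_inter, erase_eq_of_notMem fun h => hv (mem_inter.1 h).2]
  have hkR : (2 : ℝ) ≤ k := by exact_mod_cast hk2
  set R := (S.erase x).erase y with hR
  have hRc : (R.card : ℝ) = n - 2 := by
    have h1 := card_erase_add_one hx
    have h2 := card_erase_add_one (mem_erase.2 ⟨hxy.symm, hyS⟩)
    have : (R.card : ℝ) + 1 + 1 = n := by rw [← hn, ← h1, ← h2]; push_cast; ring
    linarith
  have hRA : ((R.filter (· ∈ A)).card : ℝ) = k - 1 := by
    have : R.filter (· ∈ A) = (S ∩ A).erase y := by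
      ext v
      simp only [hR, mem_filter, mem_erase, mem_inter]
      constructor
      · tauto
      · rintro ⟨h1, h2, h3⟩
        exact ⟨⟨h1, fun e => hxA (e ▸ h3), h2⟩, h3⟩
    rw [this, card_erase_of_mem hy, Nat.cast_sub hk2.le, Nat.cast_one]
  have hRnA : ((R.filter (· ∉ A)).card : ℝ) = n - 1 - k := by
    have := card_filter_add_card_filter_not (s := R) (p := (· ∈ A))
    have h2 : ((R.filter (· ∈ A)).card : ℝ) + (R.filter (· ∉ A)).card = R.card := by
      exact_mod_cast this
    linarith
  have hterm : ∀ v ∈ R, (if v ∈ A then c * (k - 2) / k else c * (k - 1) / (k + 1)) +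
      pairProb μ (S.erase v) x y ≤ matchProb μ (S.erase v) x := by
    intro v hv
    simp only [hR, mem_erase] at hv
    have := ih _ (hcard v hv.2.2) (hsub v) (y := y) (mem_erase.2 ⟨hv.2.1.symm, hx⟩)
      (mem_inter.2 ⟨mem_erase.2 ⟨hv.1.symm, hyS⟩, hyA⟩)
      (fun z hz => hmax z (inter_subset_inter_right (erase_subset _ _) hz)) rfl
    split_ifs with hvA
    · rw [hA v (mem_inter.2 ⟨hv.2.2, hvA⟩)] at this
      convert this using 3 <;> ring
    · rwa [hnA v hvA] at this
  -- Without `y`, the next best leaf `z` is the top one: it contributes `c` by hypothesis, and the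
  -- induction hypothesis for `k - 1` leaves supplies the rest.
  have hlast : c + c * (k - 2) / k ≤ matchProb μ (S.erase y) x := by
    have hne : ((S.erase y) ∩ A).Nonempty := by
      rw [erase_inter, ← card_pos, card_erase_of_mem hy]
      omega
    obtain ⟨z, hz, hzmax⟩ := exists_max_image _ ρ hne
    have hzmax' : ∀ w ∈ (S.erase y) ∩ A, w ≠ z → ρ w < ρ z := fun w hw hwz =>
      lt_of_le_of_ne (hzmax w hw) fun e => hwz (hρ (mem_inter.1 hw).2 (mem_inter.1 hz).2 e)
    have hx' : x ∈ S.erase y := mem_erase.2 ⟨hxy, hx⟩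
    have h1 := hc _ (hsub y) hx' z hz hzmax'
    have h2 := ih _ (hcard y hyS) (hsub y) hx' hz hzmax' rfl
    rw [hA y hy] at h2
    have h3 : c * ((k : ℝ) - 1 - 1) / (k - 1 + 1) = c * (k - 2) / k := by
      congr 1 <;> ring
    rw [h3] at h2
    linarith
  have hrec := h.le_card_mul_matchProb (hS.trans hT) hxy hx hyS
  have hrec' := h.card_mul_pairProb (hS.trans hT) hxy hx hyS
  have hsum := sum_le_sum hterm
  rw [sum_add_distrib, sum_ite, sum_const, sum_const, nsmul_eq_mul, nsmul_eq_mul, hRA, hRnA]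
    at hsum
  rw [hn] at hrec hrec'
  have hnpos : (0 : ℝ) < n := by
    rw [← hn]
    exact_mod_cast card_pos.2 ⟨x, hx⟩
  -- With `f k = c * (k - 1) / (k + 1)`, this is the recursion `(k + 1) * f k = k * f (k - 1) + c`.
  -- The pair probabilities cancel through `hrec'`.
  have hid : (n : ℝ) * (c * (k - 1) / (k + 1)) = (k - 1) * (c * (k - 2) / k) +
      (n - 1 - k) * (c * (k - 1) / (k + 1)) + (c + c * (k - 2) / k) := by
    field_simp
    ring
  refine le_of_mul_le_mul_left ?_ hnpos
  rw [mul_add]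
  linarith

/-- In a double star with centers `x` and `y` each of which is matched with probability almost `2c`
while the other one is absent, `x` and `y` are matched with probability at most about `1 - 2c`. -/
theorem pairProb_le (h : IsOnlineMatching N μ) {A B : Finset U} (hAB : Disjoint A B) {x y : U}
    (hxy : x ≠ y) (hxA : x ∉ A) (hxB : x ∉ B) (hyA : y ∉ A) (hyB : y ∉ B)
    (hN : ∀ v ∈ N, v = x ∨ v = y ∨ v ∈ A ∨ v ∈ B) {c : ℝ} (hc : 0 ≤ c)
    (h1 : ∀ S ⊆ N, x ∈ S → y ∉ S →
      2 * c * (S ∩ A).card / ((S ∩ A).card + 1) ≤ matchProb μ S x)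
    (h2 : ∀ S ⊆ N, y ∈ S → x ∉ S →
      2 * c * (S ∩ B).card / ((S ∩ B).card + 1) ≤ matchProb μ S y)
    {S : Finset U} (hS : S ⊆ N) (hx : x ∈ S) (hy : y ∈ S) :
    pairProb μ S x y ≤
      1 - 2 * c + 2 * c / ((S ∩ A).card + 1) + 2 * c / ((S ∩ B).card + 1) := by
  induction hn : S.card using Nat.strong_induction_on generalizing S with
  | _ n ih =>
  have hsub : ∀ v, S.erase v ⊆ N := fun v => (erase_subset _ _).trans hS
  set R := (S.erase x).erase y with hR
  set k := (S ∩ A).card with hk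
  set m := (S ∩ B).card with hm
  have hRc : (R.card : ℝ) + 2 = n := by
    have h1 := card_erase_add_one hx
    have h2 := card_erase_add_one (mem_erase.2 ⟨hxy.symm, hy⟩)
    rw [← hn, ← h1, ← h2]
    push_cast
    ring
  have hRA : R.filter (· ∈ A) = S ∩ A := by
    ext v
    simp only [hR, mem_filter, mem_erase, mem_inter]
    refine ⟨fun h => ⟨h.1.2.2, h.2⟩, fun h => ⟨⟨?_, ?_, h.1⟩, h.2⟩⟩
    · exact fun e => hyA (e ▸ h.2)
    · exact fun e => hxA (e ▸ h.2)
  have hRB : R.filter (· ∉ A) = S ∩ B := by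
    ext v
    simp only [hR, mem_filter, mem_erase, mem_inter]
    constructor
    · rintro ⟨⟨hvy, hvx, hvS⟩, hvA⟩
      have := hN v (hS hvS)
      tauto
    · rintro ⟨hvS, hvB⟩
      exact ⟨⟨fun e => hyB (e ▸ hvB), fun e => hxB (e ▸ hvB), hvS⟩,
        fun hvA => disjoint_left.1 hAB hvA hvB⟩
  have hkm : (k : ℝ) + m + 2 = n := by
    have := card_filter_add_card_filter_not (s := R) (p := (· ∈ A))
    rw [hRA, hRB] at this
    rw [← hRc, ← this]
    push_cast
    ring
  have hterm : ∀ v ∈ R, pairProb μ (S.erase v) x y ≤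
      if v ∈ A then 1 - 2 * c + 2 * c / k + 2 * c / (m + 1)
      else 1 - 2 * c + 2 * c / (k + 1) + 2 * c / m := by
    intro v hv
    have hv' := hv
    simp only [hR, mem_erase] at hv
    have := ih _ (hn ▸ card_erase_lt_of_mem hv.2.2) (hsub v) (mem_erase.2 ⟨hv.2.1.symm, hx⟩)
      (mem_erase.2 ⟨hv.1.symm, hy⟩) rfl
    split_ifs with hvA
    · have hvm : v ∈ S ∩ A := mem_inter.2 ⟨hv.2.2, hvA⟩
      have e1 : (((S.erase v) ∩ A).card : ℝ) + 1 = k := by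
        rw [erase_inter]
        exact_mod_cast card_erase_add_one hvm
      have e2 : (S.erase v) ∩ B = S ∩ B := by
        rw [erase_inter, erase_eq_of_notMem fun h =>
          disjoint_left.1 hAB hvA (mem_inter.1 h).2]
      rwa [e1, e2] at this
    · have hvm : v ∈ S ∩ B := by
        rw [← hRB]
        exact mem_filter.2 ⟨hv', hvA⟩
      have e1 : (((S.erase v) ∩ B).card : ℝ) + 1 = m := by
        rw [erase_inter]
        exact_mod_cast card_erase_add_one hvm
      have e2 : (S.erase v) ∩ A = S ∩ A := by
        rw [erase_inter, erase_eq_of_notMem fun h => hvA (mem_inter.1 h).2]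
      rwa [e1, e2] at this
  -- If `y` arrives last, `x` must still be free, although it was alone with its leaves until then.
  have hlast1 : lastProb μ S x y ≤ 1 - 2 * c * k / (k + 1) := by
    have e : (S.erase y) ∩ A = S ∩ A := by
      rw [erase_inter, erase_eq_of_notMem fun h => hyA (mem_inter.1 h).2]
    have := h1 _ (hsub y) (mem_erase.2 ⟨hxy, hx⟩) (by simp)
    rw [e] at this
    linarith [h.lastProb_le hS hy (x := x)]
  have hlast2 : lastProb μ S y x ≤ 1 - 2 * c * m / (m + 1) := by
    have e : (S.erase x) ∩ B = S ∩ B := by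
      rw [erase_inter, erase_eq_of_notMem fun h => hxB (mem_inter.1 h).2]
    have := h2 _ (hsub x) (mem_erase.2 ⟨hxy.symm, hy⟩) (by simp)
    rw [e] at this
    linarith [h.lastProb_le hS hx (x := y)]
  have hrec := h.card_mul_pairProb hS hxy hx hy
  have hsum := sum_le_sum hterm
  rw [sum_ite, sum_const, sum_const, nsmul_eq_mul, nsmul_eq_mul, hRA, hRB] at hsum
  rw [hn] at hrec
  have hnpos : (0 : ℝ) < n := by
    rw [← hn]
    exact_mod_cast card_pos.2 ⟨x, hx⟩
  refine le_of_mul_le_mul_left ?_ hnpos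
  -- For `j = 0` the quotient is `0`, so only `0 ≤ c` is needed; this covers a center without
  -- present leaves.
  have hle : ∀ j : ℕ, (j : ℝ) * (2 * c / j) ≤ 2 * c := by
    intro j
    rcases Nat.eq_zero_or_pos j with rfl | hj
    · simpa using hc
    · exact (mul_div_cancel₀ _ (by exact_mod_cast hj.ne')).le
  have hid : (n : ℝ) * (1 - 2 * c + 2 * c / (k + 1) + 2 * c / (m + 1)) =
      (k + m) * (1 - 2 * c) + 2 * c + 2 * c + k * (2 * c / (m + 1)) + m * (2 * c / (k + 1)) +
      (1 - 2 * c * k / (k + 1)) + (1 - 2 * c * m / (m + 1)) := by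
    rw [← hkm]
    field_simp
    ring
  have := hle k
  have := hle m
  linarith

end IsOnlineMatching

end Probabilities

/-! ### Matching algorithms on induced subgames -/

theorem ASHG.inputSeq_card_induce {U : Type*} [DecidableEq U] (G : ASHG U) (S : Finset U)
    (σ : (G.induce S).Order) :
    (G.induce S).inputSeq σ (G.induce S).agents.card = G.history ((G.induce S).orderList σ) := by
  rw [G.inputSeq_induce_eq_history S σ le_rfl, List.take_of_length_le (by simp), ASHG.orderList]

/-- In a graph in which every vertex has at most one neighbor of smaller or equal rank, there are no
cycles. -/
theorem SimpleGraph.isAcyclic_of_rank {V : Type*} {T : SimpleGraph V} (ρ : V → ℕ)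
    (h : ∀ v u u', T.Adj v u → T.Adj v u' → ρ u ≤ ρ v → ρ u' ≤ ρ v → u = u') : T.IsAcyclic := by
  classical
  intro a p hp
  -- A vertex of maximal rank on a cycle has two distinct neighbors there, neither of larger rank.
  obtain ⟨v, hv, hmax⟩ := exists_max_image p.support.toFinset ρ ⟨a, by simp⟩
  rw [List.mem_toFinset] at hv
  have hc := hp.rotate hv
  have hle : ∀ u ∈ (p.rotate v hv).support, ρ u ≤ ρ v := fun u hu =>
    hmax u (by simpa using hu)
  exact hc.snd_ne_penultimate (h v _ _ ((p.rotate v hv).adj_snd hc.not_nil)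
    ((p.rotate v hv).adj_penultimate hc.not_nil).symm (hle _ (by simp)) (hle _ (by simp)))

namespace OnlineAlgorithm

variable {U : Type*} [DecidableEq U]

theorem IsMatchingAlgorithm.isOnlineMatching {A : OnlineAlgorithm U} (hA : A.IsMatchingAlgorithm)
    (G : ASHG U) : IsOnlineMatching G.agents fun l => A.run (G.history l) := by
  have key : ∀ S ⊆ G.agents, ∀ l ∈ orders S, ∃ σ : (G.induce S).Order,
      (G.induce S).orderList σ = l := by
    intro S hS l hl
    rw [← G.induce_agents_of_subset hS] at hl
    exact (G.induce S).exists_orderList_eq hl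
  refine ⟨fun S hS l hl => ?_, fun S hS l hl => ?_, fun S hS v l hl => ?_⟩
  · obtain ⟨σ, rfl⟩ := key S hS l hl
    have := A.isPartitionOf (G.induce S) σ _ le_rfl
    rwa [ASHG.arrived_card, ASHG.inputSeq_card_induce, G.induce_agents_of_subset hS] at this
  · obtain ⟨σ, rfl⟩ := key S hS l hl
    have := hA (G.induce S) σ _ le_rfl
    rwa [ASHG.inputSeq_card_induce] at this
  · obtain ⟨σ, hσ⟩ := key S hS _ hl
    have hofn : (List.ofFn fun i => (σ i : U)) = l.reverse ++ [v] := by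
      rw [← List.reverse_cons, ← hσ, ASHG.orderList, List.reverse_reverse]
    have hcard : (G.induce S).agents.card = l.length + 1 := by
      simpa using congrArg List.length hofn
    have hlt : l.length < (G.induce S).agents.card := by omega
    have hv : (σ ⟨l.length, hlt⟩ : U) = v := by
      have : (List.ofFn fun i => (σ i : U))[l.length]'(by simpa using hlt) = v := by
        simp [hofn]
      simpa using this
    have := A.irrevocable (G.induce S) σ ⟨l.length, hlt⟩
    rw [G.inputSeq_induce_eq_history S σ hlt, G.inputSeq_induce_eq_history S σ hlt.le, hofn,
      List.take_of_length_le (by simp), List.take_left' (by simp), hv] at this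
    simpa using this

/-- The optimum is at least `2 * G.weight x y`. Every other coalition of the matching earns at most
a `δ` fraction of this, and there are at most `S.card` coalitions. Competitiveness thus forces the
dominant pair. -/
theorem le_pairProb {A : OnlineAlgorithm U} {D : Set (ASHG U)} {c : ℝ} (hc : 0 ≤ c)
    (hA : A.IsCompetitiveMatchingOn D c) (G : ASHG U) {S : Finset U} (hS : S ⊆ G.agents)
    (hD : G.induce S ∈ D) {x y : U} (hx : x ∈ S) (hy : y ∈ S) (hw : 0 < G.weight x y) {δ : ℚ}
    (hδ : 0 ≤ δ) (hother : ∀ u ∈ S, ∀ v ∈ S, ({u, v} : Finset U) ≠ {x, y} →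
      G.weight u v ≤ δ * G.weight x y) :
    c - S.card * δ ≤ pairProb (fun l => A.run (G.history l)) S x y := by
  classical
  have hxy := (ASHG.mem_agents_of_weight_pos hw).2.2
  have hag := G.induce_agents_of_subset hS
  have hwS : ∀ u ∈ S, ∀ v ∈ S, (G.induce S).weight u v = G.weight u v := fun u hu v hv =>
    if_pos ⟨hu, hv⟩
  have hvxy : (G.induce S).value {x, y} = 2 * G.weight x y := by
    rw [ASHG.value_pair _ hxy, hwS x hx y hy]
  have hopt : 2 * G.weight x y ≤ (G.induce S).optMatchingWelfare := by
    have hp : IsPairSet (G.induce S).agents {{x, y}} := by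
      refine ⟨fun C hC => ?_, fun C hC D hD _ _ _ => ?_⟩
      · rw [mem_singleton.1 hC, hag]
        exact ⟨by simp [insert_subset_iff, hx, hy], card_pair hxy⟩
      · rw [mem_singleton.1 hC, mem_singleton.1 hD]
    have := ASHG.socialWelfare_le_optMatchingWelfare hp.isPartitionOf_pairing
      hp.isMatching_pairing
    rwa [ASHG.socialWelfare_pairing hp, sum_singleton, hvxy] at this
  have hsw : ∀ σ : (G.induce S).Order, (G.induce S).socialWelfare (A.output (G.induce S) σ) ≤
      2 * G.weight x y * ((if {x, y} ∈ A.output (G.induce S) σ then 1 else 0) + S.card * δ) := by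
    intro σ
    have hpart := A.isPartitionOf_output (G.induce S) σ
    rw [ASHG.socialWelfare_eq_sum_value hpart]
    have hcard : (A.output (G.induce S) σ).card ≤ S.card := by
      obtain ⟨P, hP⟩ := hpart
      rw [← hP]
      exact P.card_parts_le_card.trans (by rw [hag])
    calc ∑ C ∈ A.output (G.induce S) σ, (G.induce S).value C
        ≤ ∑ C ∈ A.output (G.induce S) σ, ((if C = {x, y} then 2 * G.weight x y else 0) +
            2 * (δ * G.weight x y)) := by
          refine sum_le_sum fun C hC => ?_
          have hCS : C ⊆ S := hag ▸ hpart.subset hC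
          split_ifs with h
          · rw [h, hvxy]
            have := mul_nonneg hδ hw.le
            linarith
          · rw [zero_add]
            have hm := hA.1 (G.induce S) σ _ le_rfl C hC
            rcases hm.lt_or_eq with hm | hm
            · refine le_trans (sum_nonpos fun u hu => sum_nonpos fun v hv => ?_)
                (mul_nonneg zero_le_two (mul_nonneg hδ hw.le))
              rw [card_le_one.1 (Nat.lt_succ_iff.1 hm) u hu v hv, ASHG.weight_self]
            · obtain ⟨u, v, huv, rfl⟩ := card_eq_two.1 hm
              have hu : u ∈ S := hCS (by simp)
              have hv : v ∈ S := hCS (by simp)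
              rw [ASHG.value_pair _ huv, hwS u hu v hv]
              linarith [hother u hu v hv h]
      _ = 2 * G.weight x y * ((if {x, y} ∈ A.output (G.induce S) σ then 1 else 0) +
            (A.output (G.induce S) σ).card * δ) := by
          rw [sum_add_distrib, sum_ite_eq', sum_const, nsmul_eq_mul]
          split_ifs <;> ring
      _ ≤ _ := by
          have : ((A.output (G.induce S) σ).card : ℚ) ≤ S.card := by exact_mod_cast hcard
          gcongr
  have hcomp := hA.2 _ hD
  have hpos : (0 : ℚ) < (G.induce S).optMatchingWelfare := by linarith
  rw [welfareRatio, if_neg hpos.ne'] at hcomp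
  have hposR : (0 : ℝ) < (G.induce S).optMatchingWelfare := by exact_mod_cast hpos
  rw [le_div_iff₀ hposR] at hcomp
  have hwR : (0 : ℝ) < G.weight x y := by exact_mod_cast hw
  have hoptR : 2 * (G.weight x y : ℝ) ≤ (G.induce S).optMatchingWelfare := by
    exact_mod_cast hopt
  have hexp : ((A.expectedWelfare (G.induce S) : ℚ) : ℝ) ≤ 2 * G.weight x y *
      (pairProb (fun l => A.run (G.history l)) S x y + S.card * δ) := by
    have hprob : pairProb (fun l => A.run (G.history l)) S x y =
        (∑ σ : (G.induce S).Order, if {x, y} ∈ A.output (G.induce S) σ then (1 : ℝ) else 0) /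
          Fintype.card (G.induce S).Order := by
      have := (G.induce S).sum_order fun l => if {x, y} ∈ A.run (G.history l) then (1 : ℝ) else 0
      have e : pairProb (fun l => A.run (G.history l)) S x y = orderMean (G.induce S).agents
          fun l => if {x, y} ∈ A.run (G.history l) then (1 : ℝ) else 0 := by
        rw [hag, pairProb]
      rw [e, ← this]
      simp only [output, ASHG.inputSeq_card_induce]
    have hcpos : (0 : ℝ) < Fintype.card (G.induce S).Order := by
      have : Nonempty (G.induce S).Order := ⟨(G.induce S).agents.equivFin.symm⟩
      exact_mod_cast Fintype.card_pos
    rw [hprob, expectedWelfare]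
    push_cast
    rw [div_le_iff₀ hcpos]
    calc _ ≤ ∑ σ : (G.induce S).Order, 2 * (G.weight x y : ℝ) *
          ((if {x, y} ∈ A.output (G.induce S) σ then 1 else 0) + S.card * δ) := by
          refine sum_le_sum fun σ _ => ?_
          have h := (Rat.cast_le (K := ℝ)).2 (hsw σ)
          push_cast [apply_ite (Rat.cast : ℚ → ℝ)] at h
          exact h
      _ = _ := by
          rw [← mul_sum, sum_add_distrib, sum_const, card_univ, nsmul_eq_mul]
          field_simp
  have h1 := (mul_le_mul_of_nonneg_left hoptR hc).trans (hcomp.trans hexp)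
  have h2 : c * (2 * (G.weight x y : ℝ)) = 2 * G.weight x y * c := by ring
  rw [h2] at h1
  linarith [le_of_mul_le_mul_left h1 (by linarith)]

end OnlineAlgorithm

/-- The double star on the natural numbers with adjacent centers `0` and `1`, whose leaves are the
other even and odd numbers, respectively: the center adjacent to `n > 0`. -/
def doubleStarParent (n : ℕ) : ℕ := if n = 1 then 0 else n % 2

/-- The exponent of the weight of the edge between `n` and `doubleStarParent n`. -/
def doubleStarRank (K n : ℕ) : ℕ := if n = 1 then K + 1 else n / 2

/-- The leaves of the double star that are adjacent to the center `r`. -/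
def doubleStarLeaves (K r : ℕ) : Finset ℕ := (range (2 * K + 2)).filter fun n => 2 ≤ n ∧ n % 2 = r

theorem mem_doubleStarLeaves {K r n : ℕ} :
    n ∈ doubleStarLeaves K r ↔ n < 2 * K + 2 ∧ 2 ≤ n ∧ n % 2 = r := by
  rw [doubleStarLeaves, mem_filter, mem_range]

theorem card_doubleStarLeaves {K r : ℕ} (hr : r < 2) : (doubleStarLeaves K r).card = K := by
  have : doubleStarLeaves K r = (range K).image fun i => 2 * i + 2 + r := by
    ext n
    rw [mem_doubleStarLeaves, mem_image]
    simp only [mem_range]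
    constructor
    · rintro ⟨h1, h2, h3⟩
      exact ⟨n / 2 - 1, by omega, by omega⟩
    · rintro ⟨i, hi, rfl⟩
      omega
  rw [this, card_image_of_injective _ fun i j h => by simpa using h, card_range]

/-- The weights of the double star. -/
def doubleStarWeight (W K m n : ℕ) : ℚ :=
  if m ≠ n ∧ min m n = doubleStarParent (max m n) then (W : ℚ) ^ doubleStarRank K (max m n) else 0

theorem doubleStarWeight_pos_iff {W K m n : ℕ} (hW : 0 < W) :
    0 < doubleStarWeight W K m n ↔ m ≠ n ∧ min m n = doubleStarParent (max m n) := by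
  rw [doubleStarWeight]
  split_ifs with h
  · exact iff_of_true (pow_pos (by exact_mod_cast hW) _) h
  · exact iff_of_false (lt_irrefl _) h

theorem doubleStarWeight_nonneg (W K m n : ℕ) : 0 ≤ doubleStarWeight W K m n := by
  rw [doubleStarWeight]
  split_ifs <;> positivity

theorem doubleStarParent_lt {n : ℕ} (hn : n ≠ 0) : doubleStarParent n < n := by
  rw [doubleStarParent]
  split_ifs <;> omega

theorem doubleStarWeight_parent {W K n : ℕ} (hn : n ≠ 0) :
    doubleStarWeight W K (doubleStarParent n) n = (W : ℚ) ^ doubleStarRank K n := by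
  have h := doubleStarParent_lt hn
  rw [doubleStarWeight, max_eq_right h.le, min_eq_left h.le, if_pos ⟨h.ne, rfl⟩]

/-! ### The double star game -/

namespace ASHG

variable {U : Type*} [DecidableEq U]

/-- The double star game on the first `2 * K + 2` names of the enumeration `f`. -/
noncomputable def doubleStar (f : ℕ ↪ U) (W K : ℕ) : ASHG U where
  agents := (range (2 * K + 2)).map f
  weight x y := if x ∈ (range (2 * K + 2)).map f ∧ y ∈ (range (2 * K + 2)).map f then
    doubleStarWeight W K (Function.invFun f x) (Function.invFun f y) else 0
  weight_symm x y := by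
    simp only [doubleStarWeight, max_comm (Function.invFun f x), min_comm (Function.invFun f x),
      ne_comm (a := Function.invFun f x), and_comm (a := x ∈ (range (2 * K + 2)).map f)]
  weight_eq_zero x y h := by
    split_ifs with hxy
    · have : x = y := by
        by_contra hne
        exact h ⟨hxy.1, hxy.2, hne⟩
      simp [this, doubleStarWeight]
    · rfl

variable {f : ℕ ↪ U} {W K : ℕ}

theorem mem_doubleStar_agents {x : U} :
    x ∈ (doubleStar f W K).agents ↔ ∃ n < 2 * K + 2, f n = x := by
  simp [doubleStar]

theorem doubleStar_weight {m n : ℕ} (hm : m < 2 * K + 2) (hn : n < 2 * K + 2) :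
    (doubleStar f W K).weight (f m) (f n) = doubleStarWeight W K m n := by
  simp only [doubleStar]
  rw [if_pos ⟨mem_map_of_mem f (mem_range.2 hm), mem_map_of_mem f (mem_range.2 hn)⟩,
    Function.leftInverse_invFun f.injective, Function.leftInverse_invFun f.injective]

theorem doubleStar_isAcyclic (hW : 0 < W) :
    (doubleStar f W K).positiveGraph.IsAcyclic := by
  refine SimpleGraph.isAcyclic_of_rank (Function.invFun f) fun v u u' hu hu' hle hle' => ?_
  have hu1 := mem_agents_of_weight_pos hu
  have hu1' := mem_agents_of_weight_pos hu'
  obtain ⟨n, hn, rfl⟩ := mem_doubleStar_agents.1 hu1.1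
  obtain ⟨m, hm, rfl⟩ := mem_doubleStar_agents.1 hu1.2.1
  obtain ⟨m', hm', rfl⟩ := mem_doubleStar_agents.1 hu1'.2.1
  simp only [Function.leftInverse_invFun f.injective _] at hle hle'
  have h1 : 0 < (doubleStar f W K).weight (f n) (f m) := hu
  have h2 : 0 < (doubleStar f W K).weight (f n) (f m') := hu'
  rw [doubleStar_weight hn hm, doubleStarWeight_pos_iff hW, max_eq_left hle, min_eq_right hle] at h1
  rw [doubleStar_weight hn hm', doubleStarWeight_pos_iff hW, max_eq_left hle',
    min_eq_right hle'] at h2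
  rw [h1.2, h2.2]

theorem doubleStar_weight_nonneg (x y : U) : 0 ≤ (doubleStar f W K).weight x y := by
  simp only [doubleStar]
  split_ifs
  · exact doubleStarWeight_nonneg _ _ _ _
  · exact le_rfl

/-- Acyclicity passes to subgraphs, and the condition on negative edges is vacuous because no weight
is negative. -/
theorem doubleStar_induce_mem_treeDomain (hW : 0 < W) (S : Finset U) :
    (doubleStar f W K).induce S ∈ treeDomain U := by
  refine ⟨(doubleStar_isAcyclic (f := f) (K := K) hW).anti fun x y h => ?_, fun x y h => ?_⟩
  · simp only [positiveGraph, induce] at h ⊢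
    split_ifs at h with hS
    · exact h
    · exact absurd h (lt_irrefl _)
  · simp only [induce] at h
    split_ifs at h
    · exact absurd h (doubleStar_weight_nonneg x y).not_gt
    · exact absurd h (lt_irrefl _)

end ASHG

/-! ### The bound of one third -/

namespace OnlineAlgorithm

variable {U : Type*} [DecidableEq U]

/-- The edge from `n` to its parent has the largest exponent among the present edges, so it
outweighs each of the others by a factor of at least `W`. This is the case `δ = 1 / W` of
`le_pairProb`. -/
theorem le_pairProb_doubleStar {A : OnlineAlgorithm U} {c : ℝ} (hc : 0 ≤ c)
    (hA : A.IsCompetitiveMatchingOn (ASHG.treeDomain U) c) (f : ℕ ↪ U) {W K : ℕ} (hW : 0 < W)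
    {S : Finset U} (hS : S ⊆ (ASHG.doubleStar f W K).agents) {n : ℕ} (hn : n ≠ 0)
    (hp : f (doubleStarParent n) ∈ S) (hnS : f n ∈ S)
    (hmax : ∀ m ≠ 0, m ≠ n → f m ∈ S → f (doubleStarParent m) ∈ S →
      doubleStarRank K m < doubleStarRank K n) :
    c - (2 * K + 2) / W ≤ pairProb (fun l => A.run ((ASHG.doubleStar f W K).history l)) S
      (f (doubleStarParent n)) (f n) := by
  have hlt : ∀ m, f m ∈ S → m < 2 * K + 2 := by
    intro m hm
    obtain ⟨k, hk, hkm⟩ := ASHG.mem_doubleStar_agents.1 (hS hm)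
    rwa [← f.injective hkm]
  have hWQ : (0 : ℚ) < W := by exact_mod_cast hW
  have hW1 : (1 : ℚ) ≤ W := by exact_mod_cast hW
  have hw : (ASHG.doubleStar f W K).weight (f (doubleStarParent n)) (f n) =
      (W : ℚ) ^ doubleStarRank K n := by
    rw [ASHG.doubleStar_weight (hlt _ hp) (hlt _ hnS), doubleStarWeight_parent hn]
  have key := le_pairProb hc hA (ASHG.doubleStar f W K) hS
    (ASHG.doubleStar_induce_mem_treeDomain hW S) hp hnS (hw ▸ pow_pos hWQ _)
    (δ := 1 / W) (by positivity) ?_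
  · refine le_trans ?_ key
    have hcard : S.card ≤ 2 * K + 2 := by
      simpa [ASHG.doubleStar] using card_le_card hS
    have hcardR : (S.card : ℝ) ≤ 2 * K + 2 := by exact_mod_cast hcard
    push_cast
    rw [mul_one_div]
    gcongr
  · rw [hw]
    intro u hu v hv huv
    obtain ⟨m, hm, rfl⟩ := ASHG.mem_doubleStar_agents.1 (hS hu)
    obtain ⟨m', hm', rfl⟩ := ASHG.mem_doubleStar_agents.1 (hS hv)
    rw [ASHG.doubleStar_weight hm hm', doubleStarWeight]
    split_ifs with h
    · have hM0 : max m m' ≠ 0 := by omega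
      have hMS : f (max m m') ∈ S := by
        rcases max_choice m m' with e | e <;> rw [e] <;> assumption
      have hmS : f (min m m') ∈ S := by
        rcases min_choice m m' with e | e <;> rw [e] <;> assumption
      have hMn : max m m' ≠ n := by
        rintro hMn
        apply huv
        rw [← hMn, ← h.2]
        rcases le_total m m' with e | e
        · rw [max_eq_right e, min_eq_left e]
        · rw [max_eq_left e, min_eq_right e, pair_comm]
      have := hmax _ hM0 hMn hMS (h.2 ▸ hmS)
      rw [div_mul_eq_mul_div, one_mul, le_div_iff₀ hWQ, ← pow_succ]
      exact pow_le_pow_right₀ hW1 this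
    · positivity

/-- Here `r` and `b` are the two centers in either order. While `b` is absent, its leaves are
isolated and the present edges form a star around `r`, to which `add_pairProb_le_matchProb` applies.
-/
theorem le_matchProb_doubleStar {A : OnlineAlgorithm U} {c : ℝ} (hc : 0 ≤ c)
    (hA : A.IsCompetitiveMatchingOn (ASHG.treeDomain U) c) (f : ℕ ↪ U) {W K : ℕ} (hW : 0 < W)
    {r b : ℕ} (hrb : r + b = 1) {S : Finset U} (hS : S ⊆ (ASHG.doubleStar f W K).agents)
    (hr : f r ∈ S) (hb : f b ∉ S) :
    2 * (c - (2 * K + 2) / W) * (S ∩ (doubleStarLeaves K r).map f).card /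
        ((S ∩ (doubleStarLeaves K r).map f).card + 1) ≤
      matchProb (fun l => A.run ((ASHG.doubleStar f W K).history l)) S (f r) := by
  have hinv : ∀ n, Function.invFun f (f n) = n := Function.leftInverse_invFun f.injective
  have hlt : ∀ T ⊆ (ASHG.doubleStar f W K).agents, ∀ m, f m ∈ T → m < 2 * K + 2 := by
    intro T hT m hm
    obtain ⟨k, hk, hkm⟩ := ASHG.mem_doubleStar_agents.1 (hT hm)
    rwa [← f.injective hkm]
  set D := (doubleStarLeaves K r).map f with hD
  have hmatch : ∀ T ⊆ S, f r ∈ T → ∀ y ∈ T ∩ D,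
      (∀ z ∈ T ∩ D, z ≠ y → Function.invFun f z < Function.invFun f y) →
      c - (2 * K + 2) / W ≤
        pairProb (fun l => A.run ((ASHG.doubleStar f W K).history l)) T (f r) y := by
    intro T hT hrT y hy hmax
    obtain ⟨hyT, hyD⟩ := mem_inter.1 hy
    obtain ⟨n, hn, rfl⟩ := mem_map.1 hyD
    obtain ⟨hn1, hn2, hn3⟩ := mem_doubleStarLeaves.1 hn
    have hpn : doubleStarParent n = r := by
      rw [doubleStarParent, if_neg (by omega), hn3]
    have := le_pairProb_doubleStar hc hA f hW (hT.trans hS) (n := n) (by omega) (hpn ▸ hrT) hyT ?_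
    · rwa [hpn] at this
    · intro m hm0 hmn hmT hmp
      have hm1 : m ≠ 1 := by
        rintro rfl
        have h0 : f 0 ∈ S := hT (by simpa [doubleStarParent] using hmp)
        have h1 : f 1 ∈ S := hT hmT
        rcases (by omega : b = 0 ∨ b = 1) with rfl | rfl
        · exact hb h0
        · exact hb h1
      rw [doubleStarParent, if_neg hm1] at hmp
      have hmb : m % 2 ≠ b := fun e => hb (e ▸ hT hmp)
      have hmD : f m ∈ T ∩ D := mem_inter.2 ⟨hmT, mem_map_of_mem f (mem_doubleStarLeaves.2
        ⟨hlt T (hT.trans hS) m hmT, by omega, by omega⟩)⟩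
      have := hmax _ hmD fun e => hmn (f.injective e)
      rw [hinv, hinv] at this
      rw [doubleStarRank, doubleStarRank, if_neg hm1, if_neg (by omega)]
      omega
  rcases (S ∩ D).eq_empty_or_nonempty with h0 | hne
  · rw [h0]
    simp only [card_empty, Nat.cast_zero, mul_zero, zero_div]
    refine div_nonneg (sum_nonneg fun l _ => ?_) (Nat.cast_nonneg _)
    split_ifs <;> norm_num
  · have hinj : Set.InjOn (Function.invFun f) D := by
      intro x hx y hy hxy
      obtain ⟨m, -, rfl⟩ := mem_map.1 hx
      obtain ⟨n, -, rfl⟩ := mem_map.1 hy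
      rw [hinv, hinv] at hxy
      rw [hxy]
    obtain ⟨y, hy, hymax⟩ := exists_max_image _ (Function.invFun f) hne
    have hymax' : ∀ z ∈ S ∩ D, z ≠ y → Function.invFun f z < Function.invFun f y :=
      fun z hz hzy => lt_of_le_of_ne (hymax z hz) fun e =>
        hzy (hinj (mem_inter.1 hz).2 (mem_inter.1 hy).2 e)
    have hrD : f r ∉ D := by
      intro h
      obtain ⟨n, hn, hnr⟩ := mem_map.1 h
      have := (mem_doubleStarLeaves.1 hn).2.1
      have := f.injective hnr
      omega
    have h1 := (hA.1.isOnlineMatching (ASHG.doubleStar f W K)).add_pairProb_le_matchProb hS hrD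
      hinj hmatch subset_rfl hr hy hymax'
    have h2 := hmatch S subset_rfl hr y hy hymax'
    -- With `k` leaves and match bound `d`, the two contributions add up to `d + d * (k - 1) / (k +
    -- 1) = 2 * d * k / (k + 1)`.
    refine le_trans ?_ ((add_le_add_right h2 _).trans h1)
    apply le_of_eq
    field_simp
    ring

theorem not_isCompetitiveMatchingOn_treeDomain [Infinite U] (A : OnlineAlgorithm U) {c : ℝ}
    (hc : 1 / 3 < c) : ¬ A.IsCompetitiveMatchingOn (ASHG.treeDomain U) c := by
  intro hA
  let f : ℕ ↪ U := Infinite.natEmbedding U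
  have hc0 : 0 ≤ c := by linarith
  -- The final inequality reads `d * (3 * K - 1) ≤ K + 1`; this `K` rules it out for `d ≥ 1 / 3 + (c
  -- - 1 / 3) / 2`. Then `W` is chosen so large that `d` loses at most half of `c - 1 / 3`.
  obtain ⟨K, hK⟩ := exists_nat_gt ((4 / 3 + 2 * (c - 1 / 3)) / (3 * (c - 1 / 3) / 2))
  obtain ⟨W, hW⟩ := exists_nat_gt ((2 * K + 2) / ((c - 1 / 3) / 2))
  have hε : 0 < c - 1 / 3 := by linarith
  have hWR : (0 : ℝ) < W := lt_of_le_of_lt (by positivity) hW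
  have hW0 : 0 < W := by exact_mod_cast hWR
  set d := c - (2 * K + 2) / W with hd
  have hd1 : 1 / 3 + (c - 1 / 3) / 2 ≤ d := by
    have : (2 * K + 2) / (W : ℝ) ≤ (c - 1 / 3) / 2 := by
      rw [div_lt_iff₀ (by linarith)] at hW
      rw [div_le_iff₀ hWR]
      linarith
    linarith
  have hcard : ∀ r < 2, (((ASHG.doubleStar f W K).agents ∩
      (doubleStarLeaves K r).map f).card : ℝ) = K := by
    intro r hr
    rw [inter_eq_right.2, card_map, card_doubleStarLeaves hr]
    exact map_subset_map.2 (filter_subset _ _)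
  have hmem : ∀ n < 2 * K + 2, f n ∈ (ASHG.doubleStar f W K).agents := fun n hn =>
    ASHG.mem_doubleStar_agents.2 ⟨n, hn, rfl⟩
  have hleaf : ∀ r, ∀ m < 2, f m ∉ (doubleStarLeaves K r).map f := by
    intro r m hm h
    have := (mem_doubleStarLeaves.1 ((mem_map' f).1 h)).2.1
    omega
  have hle := (hA.1.isOnlineMatching (ASHG.doubleStar f W K)).pairProb_le
    (A := (doubleStarLeaves K 0).map f) (B := (doubleStarLeaves K 1).map f) (x := f 0) (y := f 1)
    (c := d) ?_ (fun e => zero_ne_one (f.injective e)) (hleaf 0 0 (by norm_num))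
    (hleaf 1 0 (by norm_num)) (hleaf 0 1 (by norm_num)) (hleaf 1 1 (by norm_num)) ?_
    (by linarith) (fun S hS h0 h1 => le_matchProb_doubleStar hc0 hA f hW0 rfl hS h0 h1)
    (fun S hS h1 h0 => le_matchProb_doubleStar hc0 hA f hW0 rfl hS h1 h0) subset_rfl
    (hmem 0 (by omega)) (hmem 1 (by omega))
  · have hge := le_pairProb_doubleStar hc0 hA f hW0 (K := K) subset_rfl one_ne_zero
      (hmem 0 (by omega)) (hmem 1 (by omega)) fun m hm0 hm1 hm _ => by
        obtain ⟨k, hk, hkm⟩ := ASHG.mem_doubleStar_agents.1 hm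
        have := f.injective hkm
        rw [doubleStarRank, doubleStarRank, if_neg hm1, if_pos rfl]
        omega
    have hge' := hge.trans hle
    rw [hcard 0 (by norm_num), hcard 1 (by norm_num), ← hd] at hge'
    have hK1 : (0 : ℝ) < K + 1 := by positivity
    have h3 : d * (3 * (K + 1)) ≤ (K + 1) + 4 * d := by
      have : (K + 1 : ℝ) * d ≤ (K + 1) * (1 - 2 * d + 2 * d / (K + 1) + 2 * d / (K + 1)) :=
        mul_le_mul_of_nonneg_left hge' hK1.le
      have e : (K + 1 : ℝ) * (1 - 2 * d + 2 * d / (K + 1) + 2 * d / (K + 1)) =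
          (K + 1) * (1 - 2 * d) + 4 * d := by
        field_simp
        ring
      rw [e] at this
      linarith
    rw [div_lt_iff₀ (by linarith)] at hK
    have h4 : 0 < 3 * (K : ℝ) - 1 := by
      by_contra h
      nlinarith
    nlinarith [mul_le_mul_of_nonneg_right hd1 h4.le]
  · rw [disjoint_map, disjoint_left]
    intro n h0 h1
    have h0 := (mem_doubleStarLeaves.1 h0).2.2
    have h1 := (mem_doubleStarLeaves.1 h1).2.2
    omega
  · intro v hv
    obtain ⟨n, hn, rfl⟩ := ASHG.mem_doubleStar_agents.1 hv
    simp only [mem_map', mem_doubleStarLeaves, f.injective.eq_iff]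
    omega

end OnlineAlgorithm

theorem mainTheorem8 (U : Type*) [DecidableEq U] [Infinite U] :
    (∀ c : ℝ, c ≤ 1 →
      (¬ ∃ A : OnlineAlgorithm U, A.IsCompetitiveMatchingOn (ASHG.treeDomain U) c) →
      ¬ ∃ A : OnlineAlgorithm U, A.IsCompetitive c) ∧
    (∀ A : OnlineAlgorithm U, A.competitiveRatio ≤ ((1 / 3 : ℝ) : EReal)) := by
  refine ⟨fun c hc h ⟨A, hA⟩ => h (A.exists_isCompetitiveMatchingOn hc hA), fun A => ?_⟩
  refine sSup_le ?_
  rintro _ ⟨c, hA, rfl⟩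
  rw [EReal.coe_le_coe_iff]
  by_contra hc
  -- The reduction needs a ratio of at most `1`; capping `c` at `1` keeps it above `1 / 3`.
  obtain ⟨B, hB⟩ := A.exists_isCompetitiveMatchingOn (min_le_right c 1)
    fun G => (min_le_left c 1).trans (hA G)
  exact B.not_isCompetitiveMatchingOn_treeDomain (lt_min (not_le.1 hc) (by norm_num)) hB
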